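/- Let $k$ be a field, let $r\ge 1$, and let $\mathbb{P}^{\mathbf n}=\mathbb{P}^{n_1}\times\cdots\times\mathbb{P}^{n_r}$ over $k$, where $\mathbf n=(n_1,\dots,n_r)\in\mathbb{N}^r$ and, if $r\ge 2$, $n_r\ge 1$. Let $S=k[x_{i,j} : 1\le i\le r,\ 0\le j\le n_i]$ be its Cox ring, $\mathbb{Z}^r$-graded so that $\deg x_{i,j}$ is the $i$-th standard basis vector $\mathbf e_i$. Let $B=\bigcap_{i=1}^r\langle x_{i,0},\dots,x_{i,n_i}\rangle$ be the irrelevant ideal, and for $\mathbf a\in\mathbb{N}^r$ put $B^{\mathbf a}=\bigcap_{i=1}^r\langle x_{i,0},\dots,x_{i,n_i}\rangle^{a_i}$. Let $|\mathbf n|=n_1+\cdots+n_r$. Let $Z\subset\mathbb{P}^{\mathbf n}$ be a closed subscheme of dimension zero (in particular, nonempty), and let $I\subset S$ be the corresponding $B$-saturated ideal, that is, the ideal generated by the homogeneous polynomials that vanish on $Z$. Then there is an integer $N$ such that the following holds for every $\mathbf a\in\mathbb{N}^r$ with $a_r=0$ and $a_i\ge N$ for all $i<r$. The minimal $\mathbb{Z}^r$-graded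 free resolution $F$ of $S/(I\cap B^{\mathbf a})$ exists and has length exactly $|\mathbf n|$. Moreover, $F$ is a virtual resolution of $S/I$: the complex $\widetilde F$ of vector bundles on $\mathbb{P}^{\mathbf n}$ that corresponds to $F$ is a locally free resolution of the sheaf $\widetilde{S/I}$. -/

import Mathlib

noncomputable section

namespace MultiProj

open MvPolynomial

/-! Cox ring of `ℙ^{n 0} × ⋯ × ℙ^{n (r-1)}`, with its `ℤ^r`-grading. -/

/-- The variables `x_{i,j}`, where `i` is a factor and `0 ≤ j ≤ n i`. -/
abbrev Var {r : ℕ} (n : Fin r → ℕ) : Type := Σ i : Fin r, Fin (n i + 1)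

/-- The Cox ring `S = k[x_{i,j}]`. -/
abbrev CoxRing (k : Type*) [Field k] {r : ℕ} (n : Fin r → ℕ) := MvPolynomial (Var n) k

/-- The degree of `x_{i,j}` is the `i`-th standard basis vector of `ℤ^r`. -/
def varDegree {r : ℕ} (n : Fin r → ℕ) (v : Var n) : Fin r → ℤ := Pi.single v.1 1

/-- The graded pieces `S_d`, for `d ∈ ℤ^r`. -/
abbrev grading (k : Type*) [Field k] {r : ℕ} (n : Fin r → ℕ) (d : Fin r → ℤ) :
    Submodule k (CoxRing k n) :=
  weightedHomogeneousSubmodule k (varDegree n) d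

instance gradedAlgebra_grading (k : Type*) [Field k] {r : ℕ} (n : Fin r → ℕ) :
    GradedAlgebra (grading k n) :=
  weightedGradedAlgebra k (varDegree n)

/-- The ideal `⟨x_{i,0}, …, x_{i,n i}⟩` of the `i`-th factor. -/
def factorIdeal (k : Type*) [Field k] {r : ℕ} (n : Fin r → ℕ) (i : Fin r) :
    Ideal (CoxRing k n) :=
  Ideal.span (Set.range fun j : Fin (n i + 1) => (X ⟨i, j⟩ : CoxRing k n))

/-- `B^a = ⋂ i, ⟨x_{i,0}, …, x_{i,n i}⟩ ^ a_i`; the irrelevant ideal is `B = B^(1,…,1)`. -/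
def irrelevantPow (k : Type*) [Field k] {r : ℕ} (n : Fin r → ℕ) (a : Fin r → ℕ) :
    Ideal (CoxRing k n) :=
  ⨅ i, factorIdeal k n i ^ a i

/-! The standard affine charts of `ℙ^n`.  A chart is given by the choice `σ` of one variable
`x_{i,σ i}` for every factor, and `U_σ` is the locus where all of these are nonzero. -/

/-- The index set of the standard affine charts. -/
abbrev Chart {r : ℕ} (n : Fin r → ℕ) : Type := ∀ i : Fin r, Fin (n i + 1)

/-- The monomial `x_σ = ∏ i, x_{i,σ i}`. -/
def chartMonomial (k : Type*) [Field k] {r : ℕ} (n : Fin r → ℕ) (σ : Chart n) : CoxRing k n :=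
  ∏ i, X ⟨i, σ i⟩

theorem chartMonomial_mem (k : Type*) [Field k] {r : ℕ} (n : Fin r → ℕ) (σ : Chart n) :
    chartMonomial k n σ ∈ grading k n (fun _ => 1) := by
  have h : IsWeightedHomogeneous (varDegree n) (∏ i, (X ⟨i, σ i⟩ : CoxRing k n))
      (∑ i, varDegree n ⟨i, σ i⟩) :=
    IsWeightedHomogeneous.prod _ _ _ fun i _ => isWeightedHomogeneous_X k _ _
  have e : (∑ i, varDegree n ⟨i, σ i⟩) = fun _ => (1 : ℤ) := by
    funext j
    simp [varDegree, Finset.sum_apply, Pi.single_apply]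
  rw [e] at h
  exact h

/-- The localization `S[1/x_σ]`. -/
abbrev Loc (k : Type*) [Field k] {r : ℕ} (n : Fin r → ℕ) (σ : Chart n) :=
  Localization.Away (chartMonomial k n σ)

/-- The localization `S[1/(x_σ x_τ)]`. -/
abbrev Loc₂ (k : Type*) [Field k] {r : ℕ} (n : Fin r → ℕ) (σ τ : Chart n) :=
  Localization.Away (chartMonomial k n σ * chartMonomial k n τ)

/-- The canonical map `S[1/x_σ] → S[1/(x_σ x_τ)]`. -/
def locLeft (k : Type*) [Field k] {r : ℕ} (n : Fin r → ℕ) (σ τ : Chart n) :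
    Loc k n σ →+* Loc₂ k n σ τ :=
  IsLocalization.Away.awayToAwayRight (chartMonomial k n σ) (chartMonomial k n τ)

/-- The canonical map `S[1/x_τ] → S[1/(x_σ x_τ)]`. -/
def locRight (k : Type*) [Field k] {r : ℕ} (n : Fin r → ℕ) (σ τ : Chart n) :
    Loc k n τ →+* Loc₂ k n σ τ :=
  IsLocalization.Away.awayToAwayLeft (chartMonomial k n τ) (chartMonomial k n σ)

/-- The sections of the line bundle `𝒪(d)` over `U_σ`: the elements of degree `d` of
`S[1/x_σ]`, that is, the fractions `f / x_σ^m` with `f` homogeneous of degree `d + (m,…,m)`. -/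
def lineBundleSections (k : Type*) [Field k] {r : ℕ} (n : Fin r → ℕ) (σ : Chart n)
    (d : Fin r → ℤ) : Set (Loc k n σ) :=
  {z | ∃ (m : ℕ) (f : CoxRing k n), f ∈ grading k n (d + fun _ => (m : ℤ)) ∧
    z * algebraMap (CoxRing k n) (Loc k n σ) (chartMonomial k n σ ^ m) =
      algebraMap (CoxRing k n) (Loc k n σ) f}

/-- The coordinate ring of `U_σ`: the degree-zero part of `S[1/x_σ]`. -/
abbrev ChartRing (k : Type*) [Field k] {r : ℕ} (n : Fin r → ℕ) (σ : Chart n) :=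
  HomogeneousLocalization.Away (grading k n) (chartMonomial k n σ)

/-- The coordinate ring of `U_σ ∩ U_τ`: the degree-zero part of `S[1/(x_σ x_τ)]`. -/
abbrev OverlapRing (k : Type*) [Field k] {r : ℕ} (n : Fin r → ℕ) (σ τ : Chart n) :=
  HomogeneousLocalization.Away (grading k n) (chartMonomial k n σ * chartMonomial k n τ)

/-- Restriction of functions from `U_σ` to `U_σ ∩ U_τ`. -/
def restrictLeft (k : Type*) [Field k] {r : ℕ} (n : Fin r → ℕ) (σ τ : Chart n) :
    ChartRing k n σ →+* OverlapRing k n σ τ :=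
  HomogeneousLocalization.awayMap (grading k n) (chartMonomial_mem k n τ) rfl

/-- Restriction of functions from `U_τ` to `U_σ ∩ U_τ`. -/
def restrictRight (k : Type*) [Field k] {r : ℕ} (n : Fin r → ℕ) (σ τ : Chart n) :
    ChartRing k n τ →+* OverlapRing k n σ τ :=
  HomogeneousLocalization.awayMap (grading k n) (chartMonomial_mem k n σ) (mul_comm _ _)

/-- A closed subscheme `Z` of `ℙ^n`, given by its quasi-coherent ideal sheaf: an ideal of the
coordinate ring of every standard affine chart, such that the ideals of any two charts agree on
the intersection of these charts. -/
structure ClosedSubscheme (k : Type*) [Field k] {r : ℕ} (n : Fin r → ℕ) where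
  /-- The ideal of `Z ∩ U_σ` in the coordinate ring of `U_σ`. -/
  chartIdeal : ∀ σ : Chart n, Ideal (ChartRing k n σ)
  agree : ∀ σ τ : Chart n,
    (chartIdeal σ).map (restrictLeft k n σ τ) = (chartIdeal τ).map (restrictRight k n σ τ)

namespace ClosedSubscheme

variable {k : Type*} [Field k] {r : ℕ} {n : Fin r → ℕ}

/-- The dimension of `Z`, which is covered by the affine schemes `Z ∩ U_σ`.
It is `⊥` if `Z` is empty. -/
def dim (Z : ClosedSubscheme k n) : WithBot ℕ∞ :=
  ⨆ σ : Chart n, ringKrullDim (ChartRing k n σ ⧸ Z.chartIdeal σ)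

/-- A form `f` of degree `d`, that is, a global section of `𝒪(d)`, vanishes on `Z`: for every
chart `U_σ` and every section `s` of `𝒪(-d)` over `U_σ`, the function `s f` on `U_σ` lies in the
ideal of `Z ∩ U_σ`. -/
def FormVanishes (Z : ClosedSubscheme k n) (d : Fin r → ℤ) (f : CoxRing k n) : Prop :=
  ∀ σ : Chart n, ∀ s ∈ lineBundleSections k n σ (-d),
    ∃ g ∈ Z.chartIdeal σ, g.val = s * algebraMap (CoxRing k n) (Loc k n σ) f

/-- The `B`-saturated ideal corresponding to `Z`: it is generated by the homogeneous polynomials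
that vanish on `Z`. -/
def ideal (Z : ClosedSubscheme k n) : Ideal (CoxRing k n) :=
  Ideal.span {f | ∃ d : Fin r → ℤ, f ∈ grading k n d ∧ Z.FormVanishes d f}

end ClosedSubscheme

/-- A complex `F_0 ← F_1 ← F_2 ← ⋯` of finitely generated `ℤ^r`-graded free `S`-modules
`F_i = ⨁_b S(-deg i b)`; the differentials are matrices that preserve degrees. -/
structure GradedFreeComplex (k : Type*) [Field k] {r : ℕ} (n : Fin r → ℕ) where
  /-- The rank of `F_i`. -/
  rank : ℕ → ℕ
  /-- The degrees of the basis elements of `F_i`. -/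
  deg : ∀ i, Fin (rank i) → Fin r → ℤ
  /-- The matrix of the differential `F_{i+1} → F_i`. -/
  diff : ∀ i, Matrix (Fin (rank i)) (Fin (rank (i + 1))) (CoxRing k n)
  diff_mem : ∀ i p q, diff i p q ∈ grading k n (deg (i + 1) q - deg i p)
  diff_mul_diff : ∀ i, diff i * diff (i + 1) = 0

namespace GradedFreeComplex

variable {k : Type*} [Field k] {r : ℕ} {n : Fin r → ℕ}

/-- `F` is a graded free resolution of `S/I`, for a homogeneous ideal `I`: there is a degree-zero
homomorphism `F_0 → S/I` for which `0 ← S/I ← F_0 ← F_1 ← ⋯` is exact. -/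
def IsFreeResolution (F : GradedFreeComplex k n) (I : Ideal (CoxRing k n)) : Prop :=
  ∃ ε : (Fin (F.rank 0) → CoxRing k n) →ₗ[CoxRing k n] CoxRing k n ⧸ I,
    (∀ b, ∃ f ∈ grading k n (F.deg 0 b), ε (Pi.single b 1) = Ideal.Quotient.mk I f) ∧
    Function.Surjective ε ∧
    Function.Exact (F.diff 0).mulVecLin ε ∧
    ∀ i, Function.Exact (F.diff (i + 1)).mulVecLin (F.diff i).mulVecLin

/-- All entries of the differentials lie in the ideal generated by all the variables. -/
def IsMinimal (F : GradedFreeComplex k n) : Prop :=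
  ∀ i p q, F.diff i p q ∈ Ideal.span (Set.range (X : Var n → CoxRing k n))

/-- `F` is a minimal graded free resolution of `S/I`. -/
def IsMinimalFreeResolution (F : GradedFreeComplex k n) (I : Ideal (CoxRing k n)) : Prop :=
  F.IsFreeResolution I ∧ F.IsMinimal

/-- The length of `F` is exactly `l`. -/
def HasLength (F : GradedFreeComplex k n) (l : ℕ) : Prop :=
  F.rank l ≠ 0 ∧ ∀ i, l < i → F.rank i = 0

/-- The sections over `U_σ` of the vector bundle `⨁_b 𝒪(-deg i b)` that corresponds to `F_i`. -/
def sections (F : GradedFreeComplex k n) (i : ℕ) (σ : Chart n) :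
    Set (Fin (F.rank i) → Loc k n σ) :=
  {v | ∀ b, v b ∈ lineBundleSections k n σ (-F.deg i b)}

/-- The differential on sections over `U_σ`. -/
def sectionsDiff (F : GradedFreeComplex k n) (i : ℕ) (σ : Chart n)
    (v : Fin (F.rank (i + 1)) → Loc k n σ) : Fin (F.rank i) → Loc k n σ :=
  ((F.diff i).map (algebraMap (CoxRing k n) (Loc k n σ))).mulVec v

/-- `F` is a virtual resolution of `S/I`, for a homogeneous ideal `I`: the complex of vector
bundles on `ℙ^n` that corresponds to `F` is a locally free resolution of the sheaf that
corresponds to `S/I`.  The sections over `U_σ` of this sheaf are the elements of degree zero of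
`S[1/x_σ] / I S[1/x_σ]`.  The augmentation, a map of sheaves on `ℙ^n`, sends the `b`-th basis
element to a global section of the twist by `deg 0 b` of this sheaf: to a family `t` of local
sections, represented in `S[1/x_σ]`, that agree on the overlaps.  Exactness of a complex of
quasi-coherent sheaves is exactness on sections over the charts. -/
def IsVirtualResolution (F : GradedFreeComplex k n) (I : Ideal (CoxRing k n)) : Prop :=
  ∃ t : ∀ σ : Chart n, Fin (F.rank 0) → Loc k n σ,
    (∀ σ b, t σ b ∈ lineBundleSections k n σ (F.deg 0 b)) ∧
    (∀ σ τ b, locLeft k n σ τ (t σ b) - locRight k n σ τ (t τ b) ∈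
      I.map (algebraMap (CoxRing k n) (Loc₂ k n σ τ))) ∧
    ∀ σ : Chart n,
      (∀ z ∈ lineBundleSections k n σ 0, ∃ v ∈ F.sections 0 σ,
        z - ∑ b, v b * t σ b ∈ I.map (algebraMap (CoxRing k n) (Loc k n σ))) ∧
      (∀ v ∈ F.sections 0 σ,
        ∑ b, v b * t σ b ∈ I.map (algebraMap (CoxRing k n) (Loc k n σ)) ↔
          ∃ u ∈ F.sections 1 σ, F.sectionsDiff 0 σ u = v) ∧
      ∀ i, ∀ v ∈ F.sections (i + 1) σ,
        F.sectionsDiff i σ v = 0 ↔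
          ∃ u ∈ F.sections (i + 2) σ, F.sectionsDiff (i + 1) σ u = v

end GradedFreeComplex

end MultiProj

end

/-! Write S for the Cox ring, I for the ideal of Z, M = S/(I ∩ B^a), k for the residue field of S at
the ideal of all variables, and o for the factor with a_o = 0.

The sheaf statement holds because x_σ^(∑ a_i) lies in B^a: the ideals I and I ∩ B^a agree once x_σ
is inverted, and exactness of F passes to each graded piece of the localization
(`isVirtualResolution`). Existence of F is graded Nakayama, iterated.

Length at most |n|: a minimal resolution stops where Ext^i(M, k) does
(`rank_eq_zero_of_extVanishesFrom`). There is an exact sequence 0 → B^a/(I ∩ B^a) → M → S/B^a → 0.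
The ideal B^a has projective dimension at most the sum of the n_i with i ≠ o, so S/B^a has
projective dimension at most |n| when n_o ≥ 1; with one factor, S/B^a = 0. For the submodule, prime
avoidance on the finite scheme Z yields for each factor a form l_i in its variables that is a unit
on Z. It is a nonzerodivisor modulo I, and I + (l_i) contains a power of the ideal of the factor
(`exists_regular_form`). When a_i is large for i ≠ o, these forms can be divided out of B^a/(I ∩
B^a) one after the other, each being injective on the current quotient; the last one is l_o. After r
divisions all variables act nilpotently, so the Ext groups into k vanish above |n| + r, the number
of variables. Each l_i kills k, so undoing a division lowers the bound by one, down to |n|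
(`extVanishesFrom_subQuot`).

Length at least |n|: choose a chart U_σ that meets Z. Each of its |n| coordinates is integral over k
on Z ∩ U_σ. The homogenized monic equations form a regular sequence on the localization S_σ and, up
to a power of x_σ, annihilate M. Hence Ext^i(M, S_σ^d) = 0 for i < |n|. If M had projective
dimension below |n|, descending induction would give Hom(M, D) = 0 for every finite S_σ-module D,
contradicting the nonzero map from M to its localization (`not_projDimLT`). -/

namespace MultiProj

/-! ### Ext vanishing, regular sequences and minimal resolutions -/

section HomologicalAlgebra

open CategoryTheory Abelian

universe u

variable {R : Type u} [CommRing R]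

/-- The short complex of modules attached to an exact pair of linear maps. -/
abbrev exactPair {A B C : Type u} [AddCommGroup A] [Module R A] [AddCommGroup B] [Module R B]
    [AddCommGroup C] [Module R C] {f : A →ₗ[R] B} {g : B →ₗ[R] C} (h : Function.Exact f g) :
    ShortComplex (ModuleCat.{u} R) :=
  ShortComplex.moduleCatMk f g h.linearMap_comp_eq_zero

theorem exactPair_shortExact {A B C : Type u} [AddCommGroup A] [Module R A] [AddCommGroup B]
    [Module R B] [AddCommGroup C] [Module R C] {f : A →ₗ[R] B} {g : B →ₗ[R] C}
    (hf : Function.Injective f) (h : Function.Exact f g) (hg : Function.Surjective g) :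
    (exactPair h).ShortExact where
  exact := (ShortComplex.ShortExact.moduleCat_exact_iff_function_exact _).2 h
  mono_f := (ModuleCat.mono_iff_injective _).2 hf
  epi_g := (ModuleCat.epi_iff_surjective _).2 hg

/-- `Ext^i(M, Y) = 0` for all `i ≥ p`. -/
def ExtVanishesFrom (Y : Type u) [AddCommGroup Y] [Module R Y] (p : ℕ)
    (M : Type u) [AddCommGroup M] [Module R M] : Prop :=
  ∀ i, p ≤ i → ∀ e : Ext (ModuleCat.of R M) (ModuleCat.of R Y) i, e = 0

/-- The projective dimension of `M` is less than `p`. -/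
abbrev ProjDimLT (R : Type u) [CommRing R] (p : ℕ) (M : Type u) [AddCommGroup M] [Module R M] :
    Prop :=
  HasProjectiveDimensionLT (ModuleCat.of R M) p

variable {Y A B C : Type u} [AddCommGroup Y] [Module R Y] [AddCommGroup A] [Module R A]
  [AddCommGroup B] [Module R B] [AddCommGroup C] [Module R C]

theorem ProjDimLT.extVanishesFrom {p : ℕ} (h : ProjDimLT R p A) : ExtVanishesFrom (R := R) Y p A :=
  fun _ hi e => e.eq_zero_of_hasProjectiveDimensionLT p hi

theorem projDimLT_of_projective [Module.Projective R A] : ProjDimLT R 1 A :=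
  inferInstance

theorem projDimLT_of_subsingleton [Subsingleton A] (p : ℕ) : ProjDimLT R p A := by
  have := (ModuleCat.isZero_of_subsingleton (ModuleCat.of R A)).hasProjectiveDimensionLT_zero
  exact hasProjectiveDimensionLT_of_ge _ 0 p (Nat.zero_le p)

theorem ProjDimLT.mono {p q : ℕ} (hA : ProjDimLT R p A) (h : p ≤ q) : ProjDimLT R q A :=
  hasProjectiveDimensionLT_of_ge _ p q h

theorem ProjDimLT.of_equiv {p : ℕ} (hA : ProjDimLT R p A) (e : A ≃ₗ[R] B) : ProjDimLT R p B :=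
  hasProjectiveDimensionLT_of_iso e.toModuleIso p

theorem ProjDimLT.prod {p : ℕ} (hA : ProjDimLT R p A) (hB : ProjDimLT R p B) :
    ProjDimLT R p (A × B) :=
  (exactPair_shortExact (f := LinearMap.inl R A B) (g := LinearMap.snd R A B)
    LinearMap.inl_injective Function.Exact.inl_snd
    LinearMap.snd_surjective).hasProjectiveDimensionLT_X₂ p hA hB

section LongExactSequence

variable {f : A →ₗ[R] B} {g : B →ₗ[R] C} (hf : Function.Injective f) (h : Function.Exact f g)
  (hg : Function.Surjective g) (X : ModuleCat.{u} R) {i : ℕ}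
include hf h hg

theorem exists_precomp_left (hC : ∀ e : Ext (ModuleCat.of R C) X (i + 1), e = 0)
    (e : Ext (ModuleCat.of R A) X i) :
    ∃ z : Ext (ModuleCat.of R B) X i, (Ext.mk₀ (ModuleCat.ofHom f)).comp z (zero_add i) = e :=
  Ext.contravariant_sequence_exact₁ (exactPair_shortExact hf h hg) _ e (add_comm 1 i) (hC _)

theorem exists_precomp_right (hA : ∀ e : Ext (ModuleCat.of R A) X i, e = 0)
    (e : Ext (ModuleCat.of R B) X i) :
    ∃ z : Ext (ModuleCat.of R C) X i, (Ext.mk₀ (ModuleCat.ofHom g)).comp z (zero_add i) = e :=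
  Ext.contravariant_sequence_exact₂ (exactPair_shortExact hf h hg) _ e (hA _)

theorem exists_postcomp_right (hA : ∀ e : Ext X (ModuleCat.of R A) (i + 1), e = 0)
    (e : Ext X (ModuleCat.of R C) i) :
    ∃ z : Ext X (ModuleCat.of R B) i, z.comp (Ext.mk₀ (ModuleCat.ofHom g)) (add_zero i) = e :=
  Ext.covariant_sequence_exact₃ X (exactPair_shortExact hf h hg) e rfl (hA _)

theorem eq_zero_of_postcomp_left (hC : ∀ e : Ext X (ModuleCat.of R C) i, e = 0)
    (e : Ext X (ModuleCat.of R A) (i + 1))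
    (he : e.comp (Ext.mk₀ (ModuleCat.ofHom f)) (add_zero (i + 1)) = 0) : e = 0 := by
  obtain ⟨z, hz⟩ := Ext.covariant_sequence_exact₁ X (exactPair_shortExact hf h hg) e he rfl
  have : z = 0 := hC z
  subst this
  exact hz.symm.trans (Ext.zero_comp _ _ _ _ _)

end LongExactSequence

namespace ExtVanishesFrom

theorem of_subsingleton [Subsingleton A] (p : ℕ) : ExtVanishesFrom (R := R) Y p A :=
  (projDimLT_of_subsingleton p).extVanishesFrom

variable {f : A →ₗ[R] B} {g : B →ₗ[R] C} (hf : Function.Injective f) (h : Function.Exact f g)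
  (hg : Function.Surjective g)
include hf h hg

theorem middle {p : ℕ} (hA : ExtVanishesFrom (R := R) Y p A)
    (hC : ExtVanishesFrom (R := R) Y p C) : ExtVanishesFrom (R := R) Y p B := by
  intro i hi e
  obtain ⟨x, rfl⟩ := exists_precomp_right hf h hg _ (hA i hi) e
  rw [hC i hi x, Ext.comp_zero]

theorem left {p : ℕ} (hB : ExtVanishesFrom (R := R) Y p B)
    (hC : ExtVanishesFrom (R := R) Y (p + 1) C) : ExtVanishesFrom (R := R) Y p A := by
  intro i hi e
  obtain ⟨x, rfl⟩ := exists_precomp_left hf h hg _ (hC (i + 1) (by lia)) e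
  rw [hB i hi x, Ext.comp_zero]

end ExtVanishesFrom

theorem ofHom_lsmul (x : R) : ModuleCat.ofHom (LinearMap.lsmul R A x) = x • 𝟙 _ := rfl

theorem ext_smul_eq_comp (x : R) {X : ModuleCat.{u} R} {i : ℕ} (e : Ext X (ModuleCat.of R Y) i) :
    e.comp (Ext.mk₀ (ModuleCat.ofHom (LinearMap.lsmul R Y x))) (add_zero i) = x • e := by
  rw [ofHom_lsmul, ← Ext.smul_eq_comp_mk₀]

theorem ext_smul_eq_comp_left (x : R) {X : ModuleCat.{u} R} {i : ℕ}
    (e : Ext (ModuleCat.of R Y) X i) :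
    (Ext.mk₀ (ModuleCat.ofHom (LinearMap.lsmul R Y x))).comp e (zero_add i) = x • e := by
  rw [ofHom_lsmul, Ext.mk₀_smul, Ext.smul_comp, Ext.mk₀_id_comp]

theorem ext_smul_eq_zero {x : R} (hx : ∀ y : Y, x • y = 0) {X : ModuleCat.{u} R} {i : ℕ}
    (e : Ext X (ModuleCat.of R Y) i) : x • e = 0 := by
  have : LinearMap.lsmul R Y x = 0 := LinearMap.ext hx
  rw [← ext_smul_eq_comp, this, ModuleCat.ofHom_zero, Ext.mk₀_zero, Ext.comp_zero]

theorem ext_smul_eq_zero_left {x : R} (hx : ∀ y : Y, x • y = 0) {X : ModuleCat.{u} R} {i : ℕ}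
    (e : Ext (ModuleCat.of R Y) X i) : x • e = 0 := by
  have : LinearMap.lsmul R Y x = 0 := LinearMap.ext hx
  rw [← ext_smul_eq_comp_left, this, ModuleCat.ofHom_zero, Ext.mk₀_zero, Ext.zero_comp]

/-- In the long exact sequence of 0 → A → A → C → 0, multiplication by x induces multiplication by x
on Ext^i(A, Y), which is zero because x kills Y. So Ext^i(A, Y) embeds in Ext^(i+1)(C, Y), and each
division by a regular element saves one degree. -/
theorem ExtVanishesFrom.of_smul_injective {p : ℕ} {x : R} (hx : ∀ y : Y, x • y = 0)
    {g : A →ₗ[R] C} (hf : Function.Injective (LinearMap.lsmul R A x))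
    (h : Function.Exact (LinearMap.lsmul R A x) g) (hg : Function.Surjective g)
    (hC : ExtVanishesFrom (R := R) Y (p + 1) C) : ExtVanishesFrom (R := R) Y p A := by
  intro i hi e
  obtain ⟨z, rfl⟩ := exists_precomp_left hf h hg _ (hC (i + 1) (by lia)) e
  rw [ext_smul_eq_comp_left, ext_smul_eq_zero hx]

/-- A sequence which is regular on `C` and, up to an element acting invertibly on `C`, annihilates
`M`, makes `Ext^i(M, C)` vanish in degrees less than its length. -/
theorem ext_eq_zero_of_isWeaklyRegular {M : Type u} [AddCommGroup M] [Module R M] (x : R) :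
    ∀ (rs : List R) (C : Type u) [AddCommGroup C] [Module R C],
      RingTheory.Sequence.IsWeaklyRegular C rs →
      Function.Bijective (LinearMap.lsmul R C x) →
      (∀ q ∈ rs, ∀ m : M, (x * q) • m = 0) →
      ∀ i < rs.length, ∀ e : Ext (ModuleCat.of R M) (ModuleCat.of R C) i, e = 0 := by
  intro rs
  induction rs with
  | nil => simp
  | cons q rs ih =>
    intro C _ _ hreg hx hann i hi e
    rw [RingTheory.Sequence.isWeaklyRegular_cons_iff] at hreg
    -- The product x q kills M, hence e; as x is invertible on C, already q kills e.
    have hqe : q • e = 0 := by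
      have h1 : x • (q • e) = 0 := by
        rw [smul_smul]
        exact ext_smul_eq_zero_left (hann q (by simp)) e
      let ψ : C →ₗ[R] C := (LinearEquiv.ofBijective _ hx).symm.toLinearMap
      have hψ : ModuleCat.ofHom (LinearMap.lsmul R C x) ≫ ModuleCat.ofHom ψ = 𝟙 _ := by
        ext c
        exact (LinearEquiv.ofBijective _ hx).symm_apply_apply c
      have h2 : (x • (q • e)).comp (Ext.mk₀ (ModuleCat.ofHom ψ)) (add_zero i) = q • e := by
        rw [← ext_smul_eq_comp x (q • e), Ext.comp_assoc_of_third_deg_zero, Ext.mk₀_comp_mk₀, hψ,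
          Ext.comp_mk₀_id]
      rw [← h2, h1, Ext.zero_comp]
    rw [← ext_smul_eq_comp] at hqe
    have hinj : Function.Injective (LinearMap.lsmul R C q) := hreg.1
    cases i with
    | zero =>
      have : Mono (ModuleCat.ofHom (LinearMap.lsmul R C q)) :=
        (ModuleCat.mono_iff_injective _).2 hinj
      exact Ext.postcomp_mk₀_injective_of_mono (ModuleCat.of R M)
        (ModuleCat.ofHom (LinearMap.lsmul R C q)) (by simpa using hqe)
    | succ i =>
      -- Since q kills e, it comes from Ext^i(M, C/qC) under the connecting map, and that group
      -- vanishes by induction. It remains to see that x stays bijective on C/qC.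
      refine eq_zero_of_postcomp_left hinj (LinearMap.exact_lsmul_mkQ_smul_top C q)
        (Submodule.mkQ_surjective _) _ (ih (QuotSMulTop q C) hreg.2 ?_
          (fun q' hq' => hann q' (by simp [hq'])) i (by simpa using hi)) e hqe
      constructor
      · rw [injective_iff_map_eq_zero]
        intro c hc
        obtain ⟨c, rfl⟩ := Submodule.mkQ_surjective _ c
        rw [LinearMap.lsmul_apply, ← map_smul, Submodule.mkQ_apply, Submodule.Quotient.mk_eq_zero,
          Submodule.mem_smul_pointwise_iff_exists] at hc
        obtain ⟨d, -, hd⟩ := hc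
        obtain ⟨d, rfl⟩ := hx.2 d
        rw [LinearMap.lsmul_apply, smul_comm] at hd
        have := hx.1 hd
        rw [← this, Submodule.mkQ_apply, Submodule.Quotient.mk_eq_zero]
        exact Submodule.smul_mem_pointwise_smul _ _ _ trivial
      · intro c
        obtain ⟨c, rfl⟩ := Submodule.mkQ_surjective _ c
        obtain ⟨d, rfl⟩ := hx.2 c
        exact ⟨Submodule.mkQ _ d, by simp⟩

/-- A module of finite projective dimension without extensions by the finite free modules over a
noetherian algebra has no nonzero maps to finite modules over that algebra. -/
theorem linearMap_eq_zero_of_ext_eq_zero {M : Type u} [AddCommGroup M] [Module R M] {p : ℕ}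
    (hM : ProjDimLT R p M) (S : Type u) [CommRing S] [Algebra R S] [IsNoetherianRing S]
    (hS : ∀ i < p, ∀ d : ℕ, ∀ e : Ext (ModuleCat.of R M) (ModuleCat.of R (Fin d → S)) i, e = 0)
    {D : Type u} [AddCommGroup D] [Module S D] [Module R D] [IsScalarTower R S D]
    [Module.Finite S D] (φ : M →ₗ[R] D) : φ = 0 := by
  -- Descending induction on the degree p - j: in degree p the projective dimension decides. Below
  -- it, a presentation 0 → K → S^d → D → 0 lifts e to Ext(M, S^d) = 0, the obstruction lying in
  -- Ext(M, K) one degree higher. K is finite because S is noetherian.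
  have key : ∀ j ≤ p, ∀ (D : Type u) [AddCommGroup D] [Module S D] [Module R D]
      [IsScalarTower R S D] [Module.Finite S D],
      ∀ e : Ext (ModuleCat.of R M) (ModuleCat.of R D) (p - j), e = 0 := by
    intro j
    induction j with
    | zero => exact fun _ D _ _ _ _ _ e => e.eq_zero_of_hasProjectiveDimensionLT p (by simp)
    | succ j ih =>
      intro hj D _ _ _ _ _ e
      obtain ⟨d, g, hg⟩ := Module.Finite.exists_fin' S D
      let K := LinearMap.ker g
      obtain ⟨z, rfl⟩ := exists_postcomp_right (R := R) (i := p - (j + 1))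
        (f := K.subtype.restrictScalars R) (g := g.restrictScalars R)
        K.injective_subtype (LinearMap.exact_subtype_ker_map g) hg (ModuleCat.of R M)
        (by
          have h := ih (by lia) K
          have : p - j = p - (j + 1) + 1 := by lia
          rwa [this] at h) e
      rw [hS _ (by lia) d z, Ext.zero_comp]
  have h0 := key p le_rfl D
  rw [Nat.sub_self] at h0
  have h1 := h0 (Ext.mk₀ (ModuleCat.ofHom φ))
  have h2 : ModuleCat.ofHom φ = 0 := by
    apply Ext.homEquiv₀.symm.injective
    simpa using h1
  exact congrArg ModuleCat.Hom.hom h2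

/-- A resolution of a module by finite free modules. -/
structure FreeRes (R : Type u) [CommRing R] (M : Type u) [AddCommGroup M] [Module R M] where
  /-- The ranks of the free modules. -/
  rank : ℕ → ℕ
  /-- The differentials. -/
  d : ∀ i, (Fin (rank (i + 1)) → R) →ₗ[R] (Fin (rank i) → R)
  /-- The augmentation. -/
  ε : (Fin (rank 0) → R) →ₗ[R] M
  surj : Function.Surjective ε
  exact_zero : Function.Exact (d 0) ε
  exact_succ : ∀ i, Function.Exact (d (i + 1)) (d i)

namespace FreeRes

variable {M : Type u} [AddCommGroup M] [Module R M]

/-- The resolution of the first syzygy module. -/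
def shift (F : FreeRes R M) : FreeRes R (LinearMap.range (F.d 0)) where
  rank i := F.rank (i + 1)
  d i := F.d (i + 1)
  ε := (F.d 0).rangeRestrict
  surj := (F.d 0).surjective_rangeRestrict
  exact_zero v := by
    rw [← F.exact_succ 0 v, ← LinearMap.mem_ker, LinearMap.ker_rangeRestrict, LinearMap.mem_ker]
  exact_succ i := F.exact_succ (i + 1)

/-- The differentials vanish modulo the ideal `𝔪`. -/
def IsMinimalAt (F : FreeRes R M) (𝔪 : Ideal R) : Prop :=
  ∀ i v b, F.d i v b ∈ 𝔪

theorem IsMinimalAt.shift {F : FreeRes R M} {𝔪 : Ideal R} (h : F.IsMinimalAt 𝔪) :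
    F.shift.IsMinimalAt 𝔪 :=
  fun i => h (i + 1)

theorem exact_range (F : FreeRes R M) :
    Function.Exact (LinearMap.range (F.d 0)).subtype F.ε := by
  intro v
  rw [F.exact_zero v]
  simp

theorem ker_le (F : FreeRes R M) {𝔪 : Ideal R} (h : F.IsMinimalAt 𝔪) (v : Fin (F.rank 0) → R)
    (hv : F.ε v = 0) (b) : v b ∈ 𝔪 := by
  obtain ⟨w, rfl⟩ := (F.exact_zero v).1 hv
  exact h 0 w b

/-- By minimality the kernel of the augmentation lies in 𝔪F_0, so a coordinate function modulo 𝔪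
would descend to a nonzero map from M to R/𝔪. -/
theorem rank_eq_zero (F : FreeRes R M) {𝔪 : Ideal R} (h𝔪 : 𝔪 ≠ ⊤) (h : F.IsMinimalAt 𝔪)
    (hM : ∀ φ : M →ₗ[R] R ⧸ 𝔪, φ = 0) : F.rank 0 = 0 := by
  by_contra hne
  let b : Fin (F.rank 0) := ⟨0, Nat.pos_of_ne_zero hne⟩
  let ψ : (Fin (F.rank 0) → R) →ₗ[R] R ⧸ 𝔪 := 𝔪.mkQ ∘ₗ LinearMap.proj b
  have hψ : LinearMap.ker F.ε ≤ LinearMap.ker ψ := fun v hv => by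
    simpa [ψ] using Ideal.Quotient.eq_zero_iff_mem.2 (F.ker_le h v hv b)
  let φ : M →ₗ[R] R ⧸ 𝔪 :=
    (LinearMap.ker F.ε).liftQ ψ hψ ∘ₗ (F.ε.quotKerEquivOfSurjective F.surj).symm.toLinearMap
  have h1 : φ (F.ε (Pi.single b 1)) = ψ (Pi.single b 1) := by
    have : (F.ε.quotKerEquivOfSurjective F.surj).symm (F.ε (Pi.single b 1)) =
        Submodule.Quotient.mk (Pi.single b 1) := by
      rw [LinearEquiv.symm_apply_eq]
      rfl
    simp only [φ, LinearMap.comp_apply, LinearEquiv.coe_coe, this]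
    exact (LinearMap.ker F.ε).liftQ_apply ψ _
  rw [hM φ] at h1
  have h2 : (Ideal.Quotient.mk 𝔪 1) = 0 := by simpa [ψ] using h1.symm
  exact h𝔪 ((Ideal.eq_top_iff_one _).2 (Ideal.Quotient.eq_zero_iff_mem.1 h2))

/-- Vanishing of Ext^1(M, R/𝔪) extends φ to F_0. By minimality the syzygies have entries in 𝔪, and
every linear map from F_0 to R/𝔪 is zero on such vectors. -/
theorem linearMap_range_eq_zero (F : FreeRes R M) {𝔪 : Ideal R} (h : F.IsMinimalAt 𝔪)
    (hM : ExtVanishesFrom (R := R) (R ⧸ 𝔪) 1 M) (φ : LinearMap.range (F.d 0) →ₗ[R] R ⧸ 𝔪) :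
    φ = 0 := by
  obtain ⟨z, hz⟩ := exists_precomp_left (LinearMap.range (F.d 0)).injective_subtype
    F.exact_range F.surj (ModuleCat.of R (R ⧸ 𝔪)) (i := 0) (hM 1 le_rfl)
    (Ext.mk₀ (ModuleCat.ofHom φ))
  obtain ⟨ψ, rfl⟩ := Ext.homEquiv₀.symm.surjective z
  rw [Ext.homEquiv₀_symm_apply, Ext.mk₀_comp_mk₀] at hz
  have h1 := congrArg ModuleCat.Hom.hom (Ext.homEquiv₀.symm.injective hz)
  ext ⟨_, w, rfl⟩
  have h2 := LinearMap.congr_fun h1 ⟨_, w, rfl⟩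
  rw [LinearMap.zero_apply]
  refine h2.symm.trans ?_
  change ψ.hom (F.d 0 w) = 0
  rw [← Finset.univ_sum_single (F.d 0 w), map_sum]
  refine Finset.sum_eq_zero fun b _ => ?_
  have h3 : (Pi.single b (F.d 0 w b) : Fin (F.rank 0) → R) = F.d 0 w b • Pi.single b 1 := by
    rw [← Pi.single_smul, smul_eq_mul, mul_one]
  rw [h3, map_smul]
  obtain ⟨y, hy⟩ := Ideal.Quotient.mk_surjective (ψ.hom (Pi.single b 1))
  rw [← hy, ← Ideal.Quotient.mk_eq_mk, ← Submodule.Quotient.mk_smul,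
    Ideal.Quotient.mk_eq_mk, Ideal.Quotient.eq_zero_iff_mem]
  exact 𝔪.mul_mem_right _ (h 0 w b)

/-- F_1 = 0 because the first syzygy module has no nonzero maps to R/𝔪. That module is then zero,
and the argument repeats on the shifted resolution. -/
theorem rank_succ_eq_zero {𝔪 : Ideal R} (h𝔪 : 𝔪 ≠ ⊤) (j : ℕ) :
    ∀ {M : Type u} [AddCommGroup M] [Module R M] (F : FreeRes R M), F.IsMinimalAt 𝔪 →
      ExtVanishesFrom (R := R) (R ⧸ 𝔪) 1 M → F.rank (j + 1) = 0 := by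
  induction j with
  | zero =>
    exact fun F h hM => F.shift.rank_eq_zero h𝔪 h.shift (F.linearMap_range_eq_zero h hM)
  | succ j ih =>
    intro M _ _ F h hM
    have h0 : F.rank 1 = 0 := F.shift.rank_eq_zero h𝔪 h.shift (F.linearMap_range_eq_zero h hM)
    have : IsEmpty (Fin (F.shift.rank 0)) := by rw [show F.shift.rank 0 = 0 from h0]; infer_instance
    have : Subsingleton (LinearMap.range (F.d 0)) := F.shift.surj.subsingleton
    exact ih F.shift h.shift (ExtVanishesFrom.of_subsingleton 1)

/-- A minimal resolution has no terms in degrees above those of the nonzero extensions by the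
residue field. -/
theorem rank_eq_zero_of_extVanishesFrom {𝔪 : Ideal R} (h𝔪 : 𝔪 ≠ ⊤) (p : ℕ) :
    ∀ {M : Type u} [AddCommGroup M] [Module R M] (F : FreeRes R M), F.IsMinimalAt 𝔪 →
      ExtVanishesFrom (R := R) (R ⧸ 𝔪) (p + 1) M → ∀ j, p < j → F.rank j = 0 := by
  induction p with
  | zero =>
    intro M _ _ F h hM j hj
    obtain ⟨j, rfl⟩ := Nat.exists_eq_add_of_lt hj
    rw [zero_add]
    exact F.rank_succ_eq_zero h𝔪 j h hM
  | succ p ih =>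
    intro M _ _ F h hM j hj
    obtain ⟨j, rfl⟩ := Nat.exists_eq_add_of_lt hj
    refine ih F.shift h.shift (ExtVanishesFrom.left (LinearMap.range (F.d 0)).injective_subtype
      F.exact_range F.surj ?_ hM) (p + 1 + j) (by lia)
    exact (projDimLT_of_projective.mono (by lia)).extVanishesFrom

/-- Used in contrapositive form: a lower bound on the projective dimension forces a nonzero term in
the resolution. Exactness of the terms beyond p plays no role. -/
theorem projDimLT_of_rank_eq_zero (p : ℕ) :
    ∀ {M : Type u} [AddCommGroup M] [Module R M] (F : FreeRes R M), F.rank p = 0 →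
      ProjDimLT R p M := by
  induction p with
  | zero =>
    intro M _ _ F h
    have : IsEmpty (Fin (F.rank 0)) := by rw [h]; infer_instance
    have : Subsingleton M := F.surj.subsingleton
    exact projDimLT_of_subsingleton 0
  | succ p ih =>
    intro M _ _ F h
    exact (exactPair_shortExact (LinearMap.range (F.d 0)).injective_subtype F.exact_range
      F.surj).hasProjectiveDimensionLT_X₃ p (ih F.shift h)
      (projDimLT_of_projective.mono (by lia))

end FreeRes

end HomologicalAlgebra

/-! ### Projective dimension of truncated monomial ideals and of the residue field -/

section MonomialIdeals

open CategoryTheory MvPolynomial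

universe u

/-- The hypotheses say that I₃ = x I₂ + I₁ and that x is a nonzerodivisor modulo I₁. They make 0 →
I₁ → I₂ × I₁ → I₃ → 0 exact, with maps u ↦ (u, -xu) and (u, w) ↦ xu + w. -/
theorem projDimLT_of_mul_sup {R : Type u} [CommRing R] {I₁ I₂ I₃ : Ideal R} (x : R)
    (h₁₂ : I₁ ≤ I₂) (h₁₃ : I₁ ≤ I₃) (h₂₃ : ∀ u ∈ I₂, x * u ∈ I₃)
    (hx : ∀ u, x * u ∈ I₁ → u ∈ I₁) (h₃ : ∀ f ∈ I₃, ∃ u ∈ I₂, f - x * u ∈ I₁) {p : ℕ}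
    (p₁ : ProjDimLT R p I₁) (p₂ : ProjDimLT R (p + 1) I₂) : ProjDimLT R (p + 1) I₃ := by
  let m₁ : I₁ →ₗ[R] I₁ := LinearMap.lsmul R I₁ x
  let m₂ : I₂ →ₗ[R] I₃ :=
    ((LinearMap.lsmul R R x).domRestrict I₂).codRestrict I₃ fun u => h₂₃ u u.2
  let f : I₁ →ₗ[R] I₂ × I₁ := (Submodule.inclusion h₁₂).prod (-m₁)
  let g : I₂ × I₁ →ₗ[R] I₃ := m₂.coprod (Submodule.inclusion h₁₃)
  have hf : Function.Injective f := fun u w h =>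
    Submodule.inclusion_injective h₁₂ (congrArg Prod.fst h)
  have hg : Function.Surjective g := by
    rintro ⟨y, hy⟩
    obtain ⟨u, hu, hw⟩ := h₃ y hy
    refine ⟨(⟨u, hu⟩, ⟨_, hw⟩), Subtype.ext ?_⟩
    change x * u + (y - x * u) = y
    ring
  have hfg : Function.Exact f g := by
    rintro ⟨⟨u, hu⟩, ⟨w, hw⟩⟩
    constructor
    · intro h
      have h : x * u + w = 0 := congrArg Subtype.val h
      have hu1 : u ∈ I₁ := hx u (by rw [eq_neg_of_add_eq_zero_left h]; exact I₁.neg_mem hw)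
      refine ⟨⟨u, hu1⟩, Prod.ext rfl (Subtype.ext ?_)⟩
      change -(x * u) = w
      exact (eq_neg_of_add_eq_zero_right h).symm
    · rintro ⟨⟨u', hu'⟩, h⟩
      have h1 : u' = u := congrArg (fun z => (z.1 : R)) h
      have h2 : -(x * u') = w := congrArg (fun z => (z.2 : R)) h
      refine Subtype.ext ?_
      change x * u + w = 0
      rw [← h2, h1, add_neg_cancel]
  exact (exactPair_shortExact hf hfg hg).hasProjectiveDimensionLT_X₃ p p₁
    (p₂.prod (p₁.mono (Nat.le_succ p)))

variable {k : Type u} [Field k] {σ : Type}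

/-- The ideal generated by the monomials with exponents in `U`. -/
noncomputable def monomialIdeal (k : Type u) [Field k] (U : Set (σ →₀ ℕ)) : Ideal (MvPolynomial σ k) :=
  Ideal.span ((fun e => monomial e (1 : k)) '' U)

theorem mem_monomialIdeal {U : Set (σ →₀ ℕ)} (hU : IsUpperSet U) {f : MvPolynomial σ k} :
    f ∈ monomialIdeal k U ↔ ∀ e, coeff e f ≠ 0 → e ∈ U := by
  rw [monomialIdeal, mem_ideal_span_monomial_image]
  simp only [mem_support_iff]
  exact ⟨fun h e he => let ⟨s, hs, hse⟩ := h e he; hU hse hs, fun h e he => ⟨e, h e he, le_rfl⟩⟩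

/-- The exponents of degree at least `b` in the variables in `W`. -/
def degreeAtLeast (W : Finset σ) (b : ℕ) : Set (σ →₀ ℕ) := {e | b ≤ ∑ v ∈ W, e v}

theorem isUpperSet_degreeAtLeast (W : Finset σ) (b : ℕ) : IsUpperSet (degreeAtLeast W b) :=
  fun _ _ h he => le_trans he (Finset.sum_le_sum fun v _ => h v)

theorem span_X_pow (W : Finset σ) (b : ℕ) :
    Ideal.span ((fun v => (X v : MvPolynomial σ k)) '' W) ^ b =
      monomialIdeal k (degreeAtLeast W b) := by
  classical
  apply le_antisymm
  · induction b with
    | zero =>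
      intro f _
      exact (mem_monomialIdeal (isUpperSet_degreeAtLeast W 0)).2 fun e _ => Nat.zero_le _
    | succ b ih =>
      rw [pow_succ', Ideal.mul_le]
      intro f hf g hg
      have hg := ih hg
      induction hf using Submodule.span_induction with
      | mem f hf =>
        obtain ⟨v, hv, rfl⟩ := hf
        rw [mem_monomialIdeal (isUpperSet_degreeAtLeast _ _)] at hg ⊢
        intro e he
        rw [coeff_X_mul'] at he
        split_ifs at he with hve
        · have h1 := hg _ he
          simp only [degreeAtLeast, Set.mem_ofPred_eq] at h1 ⊢
          refine (Nat.succ_le_succ h1).trans ?_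
          have hve : 1 ≤ e v := Nat.one_le_iff_ne_zero.2 (Finsupp.mem_support_iff.1 hve)
          apply Nat.succ_le_of_lt
          refine Finset.sum_lt_sum (fun w _ => ?_) ⟨v, hv, ?_⟩
          · simp
          · simp; lia
        · exact absurd rfl he
      | zero => rw [zero_mul]; exact zero_mem _
      | add f f' _ _ h h' => rw [add_mul]; exact add_mem h h'
      | smul c f _ h => rw [smul_eq_mul, mul_assoc]; exact Ideal.mul_mem_left _ _ h
  · rw [monomialIdeal, Ideal.span_le]
    rintro _ ⟨e, he, rfl⟩
    have h1 : ∏ v ∈ W, (X v : MvPolynomial σ k) ^ e v ∈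
        Ideal.span ((fun v => (X v : MvPolynomial σ k)) '' W) ^ (∑ v ∈ W, e v) := by
      rw [← Finset.prod_pow_eq_pow_sum]
      exact Ideal.prod_mem_prod fun v hv =>
        Ideal.pow_mem_pow (Ideal.subset_span (Set.mem_image_of_mem _ hv)) _
    have h2 : ∏ v ∈ W, (X v : MvPolynomial σ k) ^ e v =
        monomial (∑ v ∈ W, Finsupp.single v (e v)) 1 := by
      rw [monomial_sum_one]
      exact Finset.prod_congr rfl fun v _ => X_pow_eq_monomial
    have h3 : ∑ v ∈ W, Finsupp.single v (e v) ≤ e := by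
      intro w
      rw [Finsupp.finsetSum_apply]
      by_cases hw : w ∈ W
      · rw [Finset.sum_eq_single w]
        · simp
        · intro v _ hv
          simp [hv]
        · exact fun h => absurd hw h
      · rw [Finset.sum_eq_zero]
        · exact Nat.zero_le _
        · intro v hv
          exact Finsupp.single_eq_of_ne (by rintro rfl; exact hw hv)
    have h4 : (monomial e (1 : k)) = monomial (e - ∑ v ∈ W, Finsupp.single v (e v)) 1 *
        ∏ v ∈ W, (X v : MvPolynomial σ k) ^ e v := by
      rw [h2, monomial_mul, mul_one, tsub_add_cancel_of_le h3]
    change monomial e (1 : k) ∈ _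
    rw [h4]
    exact Ideal.mul_mem_left _ _ (Ideal.pow_le_pow_right he h1)

theorem monomialIdeal_mono {U V : Set (σ →₀ ℕ)} (h : U ⊆ V) :
    monomialIdeal k U ≤ monomialIdeal k V :=
  Ideal.span_mono (Set.image_mono h)

theorem coeff_mul_X_ne_zero {f : MvPolynomial σ k} {v : σ} {e : σ →₀ ℕ} (h : coeff e f ≠ 0) :
    coeff (e + Finsupp.single v 1) (X v * f) ≠ 0 := by
  rwa [add_comm, coeff_X_mul]

/-- Truncating in the variables W, which U does not see, costs at most card W - 1 in projective
dimension. The induction is on W and then on b: splitting monomials by divisibility by x_v, the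
truncation at b + 1 in W ∪ {v} is x_v times the truncation at b plus the truncation at b + 1 in W
alone. For empty W and b > 0 the ideal is zero; b = 0 is excluded there because it returns U, for
which only the bound p + 1 is known. -/
theorem projDimLT_monomialIdeal {U : Set (σ →₀ ℕ)} (hU : IsUpperSet U) {p : ℕ}
    (hp : ProjDimLT (MvPolynomial σ k) (p + 1) (monomialIdeal k U)) (W : Finset σ)
    (hW : ∀ v ∈ W, ∀ e, e + Finsupp.single v 1 ∈ U → e ∈ U) :
    ∀ b : ℕ, (0 < b ∨ W.Nonempty) →
      ProjDimLT (MvPolynomial σ k) (p + W.card) (monomialIdeal k (U ∩ degreeAtLeast W b)) := by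
  classical
  induction W using Finset.induction with
  | empty =>
    intro b hb
    have hb : 0 < b := hb.resolve_right (by simp)
    have h : U ∩ degreeAtLeast ∅ b = ∅ := by
      ext e
      simp [degreeAtLeast]
      lia
    have : Subsingleton (monomialIdeal k (U ∩ degreeAtLeast ∅ b)) := by
      rw [h, monomialIdeal, Set.image_empty, Ideal.span_empty]
      infer_instance
    exact projDimLT_of_subsingleton _
  | insert v W hv ih =>
    have ih := ih fun w hw => hW w (Finset.mem_insert_of_mem hw)
    have hWv := hW v (Finset.mem_insert_self _ _)
    intro b _
    rw [Finset.card_insert_of_notMem hv, ← add_assoc]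
    induction b with
    | zero =>
      have : U ∩ degreeAtLeast (insert v W) 0 = U := Set.inter_eq_left.2 fun e _ => Nat.zero_le _
      rw [this]
      exact hp.mono (by lia)
    | succ b ihb =>
      have up := fun (W : Finset σ) b => hU.inter (isUpperSet_degreeAtLeast W b)
      have hsum : ∀ e : σ →₀ ℕ, ∑ w ∈ insert v W, e w = e v + ∑ w ∈ W, e w := fun e =>
        Finset.sum_insert hv
      have hsumW : ∀ e : σ →₀ ℕ, ∑ w ∈ W, (e + Finsupp.single v 1 : σ →₀ ℕ) w = ∑ w ∈ W, e w :=
          fun e =>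
        Finset.sum_congr rfl fun w hw => by
          rw [Finsupp.add_apply, Finsupp.single_eq_of_ne (by rintro rfl; exact hv hw), add_zero]
      refine projDimLT_of_mul_sup (I₁ := monomialIdeal k (U ∩ degreeAtLeast W (b + 1)))
        (I₂ := monomialIdeal k (U ∩ degreeAtLeast (insert v W) b)) (X v) ?_ ?_ ?_ ?_ ?_
        (ih (b + 1) (Or.inl b.succ_pos)) (ihb (Or.inr ⟨v, Finset.mem_insert_self _ _⟩))
      · refine monomialIdeal_mono fun e he => ⟨he.1, ?_⟩
        have := he.2
        simp only [degreeAtLeast, Set.mem_ofPred_eq, hsum] at this ⊢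
        lia
      · refine monomialIdeal_mono fun e he => ⟨he.1, ?_⟩
        have := he.2
        simp only [degreeAtLeast, Set.mem_ofPred_eq, hsum] at this ⊢
        lia
      · intro u hu
        rw [mem_monomialIdeal (up _ _)] at hu ⊢
        intro e he
        rw [coeff_X_mul'] at he
        split_ifs at he with hve
        · obtain ⟨h1, h2⟩ := hu _ he
          have hle : Finsupp.single v 1 ≤ e := by
            simpa [Nat.one_le_iff_ne_zero] using hve
          rw [← tsub_add_cancel_of_le hle]
          refine ⟨hU (by simp) h1, ?_⟩
          simp only [degreeAtLeast, Set.mem_ofPred_eq, hsum, hsumW] at h2 ⊢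
          simp
          simp at h2
          lia
        · exact absurd rfl he
      · intro u hu
        rw [mem_monomialIdeal (up _ _)] at hu ⊢
        intro e he
        obtain ⟨h1, h2⟩ := hu _ (coeff_mul_X_ne_zero (v := v) he)
        refine ⟨hWv _ h1, ?_⟩
        simpa only [degreeAtLeast, Set.mem_ofPred_eq, hsumW] using h2
      · intro f hf
        rw [mem_monomialIdeal (up _ _)] at hf
        refine ⟨f.divMonomial (Finsupp.single v 1), ?_, ?_⟩
        · rw [mem_monomialIdeal (up _ _)]
          intro e he
          rw [coeff_divMonomial, add_comm] at he
          obtain ⟨h1, h2⟩ := hf _ he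
          refine ⟨hWv _ h1, ?_⟩
          simp only [degreeAtLeast, Set.mem_ofPred_eq, hsum, hsumW] at h2 ⊢
          simp at h2
          lia
        · rw [mem_monomialIdeal (up _ _)]
          intro e he
          have hmod : f - X v * f.divMonomial (Finsupp.single v 1) =
              f.modMonomial (Finsupp.single v 1) := by
            rw [sub_eq_iff_eq_add', divMonomial_add_modMonomial_single]
          rw [hmod] at he
          have hle : ¬ Finsupp.single v 1 ≤ e := fun h => he (coeff_modMonomial_of_le f h)
          rw [coeff_modMonomial_of_not_le f hle] at he
          obtain ⟨h1, h2⟩ := hf _ he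
          refine ⟨h1, ?_⟩
          have hev : e v = 0 := by simpa using hle
          simpa only [degreeAtLeast, Set.mem_ofPred_eq, hsum, hev, zero_add] using h2

theorem projDimLT_quotient {R : Type u} [CommRing R] {I : Ideal R} {p : ℕ}
    (h : ProjDimLT R (p + 1) I) : ProjDimLT R (p + 2) (R ⧸ I) :=
  (exactPair_shortExact (f := I.subtype) (g := I.mkQ) I.injective_subtype
    (LinearMap.exact_subtype_mkQ I) I.mkQ_surjective).hasProjectiveDimensionLT_X₃ (p + 1) h
    (projDimLT_of_projective.mono (by lia))

theorem monomialIdeal_univ : monomialIdeal k (Set.univ : Set (σ →₀ ℕ)) = ⊤ :=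
  (Ideal.eq_top_iff_one _).2 ((mem_monomialIdeal isUpperSet_univ).2 fun _ _ => trivial)

/-- The ideal of all variables is the truncation of the unit ideal at degree 1, so the bound for
truncations replaces the Koszul complex. -/
theorem projDimLT_quotient_vars [Fintype σ] :
    ProjDimLT (MvPolynomial σ k) (Fintype.card σ + 1)
      (MvPolynomial σ k ⧸ idealOfVars σ k) := by
  have h0 : ProjDimLT (MvPolynomial σ k) (0 + 1)
      (monomialIdeal k (Set.univ : Set (σ →₀ ℕ))) := by
    rw [monomialIdeal_univ]
    have : Module.Projective (MvPolynomial σ k) (⊤ : Ideal (MvPolynomial σ k)) :=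
      Module.Projective.of_equiv Submodule.topEquiv.symm
    exact projDimLT_of_projective
  have h1 := projDimLT_monomialIdeal isUpperSet_univ h0 Finset.univ (fun _ _ _ _ => trivial) 1
    (Or.inl one_pos)
  rw [Set.univ_inter, ← span_X_pow, pow_one, Finset.coe_univ, Set.image_univ, zero_add,
    Finset.card_univ] at h1
  rcases Nat.eq_zero_or_pos (Fintype.card σ) with h | h
  · rw [h] at h1 ⊢
    have : Subsingleton (idealOfVars σ k) := by
      have := Fintype.card_eq_zero_iff.1 h
      rw [idealOfVars, Set.range_eq_empty, Ideal.span_empty]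
      infer_instance
    have e : MvPolynomial σ k ≃ₗ[MvPolynomial σ k] MvPolynomial σ k ⧸ idealOfVars σ k :=
      (Submodule.quotEquivOfEqBot _ (Submodule.eq_bot_of_subsingleton)).symm
    exact (projDimLT_of_projective (A := MvPolynomial σ k)).of_equiv e
  · obtain ⟨c, hc⟩ := Nat.exists_eq_add_of_lt h
    rw [zero_add] at hc
    rw [hc] at h1 ⊢
    exact projDimLT_quotient h1

theorem mem_idealOfVars_iff {f : MvPolynomial σ k} :
    f ∈ idealOfVars σ k ↔ constantCoeff f = 0 := by
  rw [← pow_one (idealOfVars σ k), mem_pow_idealOfVars_iff', constantCoeff_eq]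
  refine ⟨fun h => h 0 (by simp), fun h x hx => ?_⟩
  rwa [(Finsupp.degree_eq_zero_iff x).1 (by lia)]

/-- Extensions by the residue field vanish in large degrees for the finite modules on which the
variables act nilpotently. -/
theorem extVanishesFrom_of_nilpotent [Fintype σ] {M : Type u} [AddCommGroup M]
    [Module (MvPolynomial σ k) M] [Module.Finite (MvPolynomial σ k) M]
    (hM : ∀ v, ∃ m : ℕ, ∀ y : M, (X v : MvPolynomial σ k) ^ m • y = 0) :
    ExtVanishesFrom (R := MvPolynomial σ k) (MvPolynomial σ k ⧸ idealOfVars σ k)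
      (Fintype.card σ + 1) M := by
  induction ‹Module.Finite (MvPolynomial σ k) M› using
    IsNoetherianRing.induction_on_isQuotientEquivQuotientPrime (MvPolynomial σ k) with
  | subsingleton N => exact ExtVanishesFrom.of_subsingleton _
  | quotient N p e =>
    -- In a prime filtration, powers of all variables kill each factor, so its prime is the maximal
    -- ideal of the variables and the factor is the residue field.
    have hp : idealOfVars σ k ≤ p.asIdeal := by
      rw [idealOfVars, Ideal.span_le]
      rintro _ ⟨v, rfl⟩
      obtain ⟨m, hm⟩ := hM v
      have h1 := hm (e.symm (Ideal.Quotient.mk _ 1))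
      rw [← map_smul, LinearEquiv.map_eq_zero_iff, ← Ideal.Quotient.mk_eq_mk,
        ← Submodule.Quotient.mk_smul, Ideal.Quotient.mk_eq_mk, Ideal.Quotient.eq_zero_iff_mem,
        smul_eq_mul, mul_one] at h1
      exact p.2.mem_of_pow_mem _ h1
    have hmax : (idealOfVars σ k).IsMaximal := by
      have : idealOfVars σ k = RingHom.ker (constantCoeff (σ := σ) (R := k)) := by
        ext f
        rw [mem_idealOfVars_iff, RingHom.mem_ker]
      rw [this]
      exact RingHom.ker_isMaximal_of_surjective _ fun a => ⟨C a, constantCoeff_C _ _⟩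
    have hp' : idealOfVars σ k = p.asIdeal := hmax.eq_of_le p.2.ne_top hp
    have e' : (MvPolynomial σ k ⧸ idealOfVars σ k) ≃ₗ[MvPolynomial σ k] N :=
      (Submodule.quotEquivOfEq _ _ hp').trans e.symm
    exact (projDimLT_quotient_vars.of_equiv e').extVanishesFrom
  | exact N₁ N₂ N₃ f g hf hg h ih₁ ih₃ =>
    refine ExtVanishesFrom.middle hf h hg (ih₁ fun v => ?_) (ih₃ fun v => ?_)
    · obtain ⟨m, hm⟩ := hM v
      exact ⟨m, fun y => hf (by rw [map_smul, hm, map_zero])⟩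
    · obtain ⟨m, hm⟩ := hM v
      refine ⟨m, fun y => ?_⟩
      obtain ⟨y, rfl⟩ := hg y
      rw [← map_smul, hm, map_zero]

end MonomialIdeals

/-! ### Graded components; membership in B^a as a condition on degrees -/

section Grading

open MvPolynomial

universe u

variable {k : Type u} [Field k] {r : ℕ} {n : Fin r → ℕ}

/-- The component of degree `d` of a polynomial. -/
noncomputable abbrev comp (d : Fin r → ℤ) : CoxRing k n →ₗ[k] CoxRing k n :=
  weightedHomogeneousComponent (varDegree n) d

theorem weight_apply (e : Var n →₀ ℕ) (i : Fin r) :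
    Finsupp.weight (varDegree n) e i = ((∑ j, e ⟨i, j⟩ : ℕ) : ℤ) := by
  rw [Finsupp.weight_apply, Finsupp.sum_fintype _ _ (by simp), Finset.sum_apply, Fintype.sum_sigma,
    Finset.sum_eq_single i]
  · simp [varDegree]
  · intro i' _ hi'
    refine Finset.sum_eq_zero fun j _ => ?_
    simp [varDegree, hi'.symm]
  · simp

theorem mem_grading {d : Fin r → ℤ} {f : CoxRing k n} :
    f ∈ grading k n d ↔ ∀ e, coeff e f ≠ 0 → Finsupp.weight (varDegree n) e = d :=
  Iff.rfl

theorem comp_mem (d : Fin r → ℤ) (f : CoxRing k n) : comp d f ∈ grading k n d :=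
  weightedHomogeneousComponent_isWeightedHomogeneous d f

theorem comp_of_mem {d : Fin r → ℤ} {f : CoxRing k n} (hf : f ∈ grading k n d) : comp d f = f :=
  IsWeightedHomogeneous.weightedHomogeneousComponent_same hf

theorem comp_of_mem_of_ne {d d' : Fin r → ℤ} {f : CoxRing k n} (hf : f ∈ grading k n d)
    (h : d ≠ d') : comp d' f = 0 :=
  IsWeightedHomogeneous.weightedHomogeneousComponent_ne d' hf h.symm

theorem sum_comp (f : CoxRing k n) :
    ∑ d ∈ f.support.image (Finsupp.weight (varDegree n)), comp d f = f := by
  classical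
  ext e
  rw [coeff_sum]
  simp only [coeff_weightedHomogeneousComponent]
  rw [Finset.sum_ite_eq]
  split_ifs with h
  · rfl
  · by_contra he
    exact h (Finset.mem_image_of_mem _ (mem_support_iff.2 (Ne.symm he)))

theorem comp_mul_left {δ : Fin r → ℤ} {g : CoxRing k n} (hg : g ∈ grading k n δ)
    (f : CoxRing k n) (d : Fin r → ℤ) : comp (δ + d) (g * f) = g * comp d f := by
  have h : ∀ x, comp (δ + d) (g * comp x f) = if d = x then g * comp d f else 0 := by
    intro x
    split_ifs with h
    · rw [h]
      exact comp_of_mem (IsWeightedHomogeneous.mul hg (comp_mem x f))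
    · exact comp_of_mem_of_ne (IsWeightedHomogeneous.mul hg (comp_mem x f))
        fun h' => h (add_left_cancel h').symm
  conv_lhs => rw [← sum_comp f, Finset.mul_sum, map_sum]
  simp only [h, Finset.sum_ite_eq]
  split_ifs with hd
  · rfl
  · have : comp d f = 0 := by
      ext e
      rw [coeff_weightedHomogeneousComponent, coeff_zero, ite_eq_right_iff]
      intro he
      by_contra hne
      exact hd (Finset.mem_image.2 ⟨e, mem_support_iff.2 hne, he⟩)
    rw [this, mul_zero]

/-- An ideal which contains the components of its elements. -/
def IsHomog (I : Ideal (CoxRing k n)) : Prop :=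
  ∀ f ∈ I, ∀ d, comp d f ∈ I

theorem mem_of_comp_mem {I : Ideal (CoxRing k n)} {f : CoxRing k n} (h : ∀ d, comp d f ∈ I) :
    f ∈ I := by
  rw [← sum_comp f]
  exact sum_mem fun d _ => h d

theorem IsHomog.inf {I J : Ideal (CoxRing k n)} (hI : IsHomog I) (hJ : IsHomog J) :
    IsHomog (I ⊓ J) :=
  fun f hf d => ⟨hI f hf.1 d, hJ f hf.2 d⟩

theorem IsHomog.span {s : Set (CoxRing k n)} (hs : ∀ f ∈ s, ∃ d, f ∈ grading k n d) :
    IsHomog (Ideal.span s) := by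
  intro f hf
  induction hf using Submodule.span_induction with
  | mem f hf =>
    intro d
    obtain ⟨d', hd'⟩ := hs f hf
    by_cases h : d' = d
    · subst h
      rw [comp_of_mem hd']
      exact Ideal.subset_span hf
    · rw [comp_of_mem_of_ne hd' h]
      exact zero_mem _
  | zero => intro d; rw [map_zero]; exact zero_mem _
  | add f g _ _ hf hg => intro d; rw [map_add]; exact add_mem (hf d) (hg d)
  | smul c f _ hf =>
    intro d
    rw [smul_eq_mul, ← sum_comp c, Finset.sum_mul, map_sum]
    refine sum_mem fun d' _ => ?_
    have := comp_mul_left (comp_mem d' c) f (d - d')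
    rw [add_sub_cancel] at this
    rw [this]
    exact Ideal.mul_mem_left _ _ (hf _)

theorem grading_mul {d d' : Fin r → ℤ} {f g : CoxRing k n} (hf : f ∈ grading k n d)
    (hg : g ∈ grading k n d') : f * g ∈ grading k n (d + d') :=
  IsWeightedHomogeneous.mul hf hg

theorem grading_pow {d : Fin r → ℤ} {f : CoxRing k n} (hf : f ∈ grading k n d) (m : ℕ) :
    f ^ m ∈ grading k n (m • d) :=
  IsWeightedHomogeneous.pow hf m

theorem X_mem_grading (v : Var n) : (X v : CoxRing k n) ∈ grading k n (Pi.single v.1 1) :=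
  isWeightedHomogeneous_X k _ v

theorem C_mem_grading (c : k) : (C c : CoxRing k n) ∈ grading k n 0 :=
  isWeightedHomogeneous_C _ c

theorem one_mem_grading : (1 : CoxRing k n) ∈ grading k n 0 := isWeightedHomogeneous_one k _

theorem chartMonomial_pow_mem (σ : Chart n) (m : ℕ) :
    chartMonomial k n σ ^ m ∈ grading k n (fun _ => (m : ℤ)) := by
  have h := grading_pow (chartMonomial_mem k n σ) m
  have e : m • (fun _ => 1 : Fin r → ℤ) = fun _ => (m : ℤ) := by
    funext i
    simp
  rwa [e] at h

theorem nonneg_of_mem_grading {d : Fin r → ℤ} {f : CoxRing k n} (hf : f ∈ grading k n d)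
    (h : f ≠ 0) : 0 ≤ d := by
  obtain ⟨e, he⟩ := ne_zero_iff.1 h
  rw [← mem_grading.1 hf e he]
  intro i
  rw [weight_apply]
  exact Int.natCast_nonneg _

/-- The variables of the `i`-th factor. -/
def factorVars (n : Fin r → ℕ) (i : Fin r) : Finset (Var n) :=
  Finset.univ.map ⟨Sigma.mk i, sigma_mk_injective⟩

theorem sum_factorVars (e : Var n → ℕ) (i : Fin r) : ∑ v ∈ factorVars n i, e v = ∑ j, e ⟨i, j⟩ := by
  simp [factorVars]

theorem card_factorVars (i : Fin r) : (factorVars n i).card = n i + 1 := by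
  simp [factorVars]

theorem factorIdeal_pow (i : Fin r) (b : ℕ) :
    factorIdeal k n i ^ b = monomialIdeal k (degreeAtLeast (factorVars n i) b) := by
  rw [← span_X_pow, factorIdeal]
  congr 2
  ext f
  simp [factorVars]

theorem mem_factorIdeal_pow {i : Fin r} {b : ℕ} {f : CoxRing k n} :
    f ∈ factorIdeal k n i ^ b ↔
      ∀ e, coeff e f ≠ 0 → (b : ℤ) ≤ Finsupp.weight (varDegree n) e i := by
  rw [factorIdeal_pow, mem_monomialIdeal (isUpperSet_degreeAtLeast _ _)]
  simp only [degreeAtLeast, Set.mem_ofPred_eq, sum_factorVars, weight_apply, Nat.cast_le]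

theorem mem_irrelevantPow {a : Fin r → ℕ} {f : CoxRing k n} :
    f ∈ irrelevantPow k n a ↔
      ∀ e, coeff e f ≠ 0 → ∀ i, (a i : ℤ) ≤ Finsupp.weight (varDegree n) e i := by
  simp only [irrelevantPow, Submodule.mem_iInf, mem_factorIdeal_pow]
  exact ⟨fun h e he i => h i e he, fun h i e he => h e he i⟩

theorem isHomog_irrelevantPow (a : Fin r → ℕ) : IsHomog (irrelevantPow k n a) := by
  intro f hf d
  rw [mem_irrelevantPow] at hf ⊢
  intro e he
  rw [coeff_weightedHomogeneousComponent] at he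
  exact hf e fun h => he (by simp [h])

theorem mem_irrelevantPow_of_le {a : Fin r → ℕ} {d : Fin r → ℤ} {f : CoxRing k n}
    (hf : f ∈ grading k n d) (h : ∀ i, (a i : ℤ) ≤ d i) : f ∈ irrelevantPow k n a :=
  mem_irrelevantPow.2 fun e he i => by rw [mem_grading.1 hf e he]; exact h i

theorem le_of_mem_irrelevantPow {a : Fin r → ℕ} {d : Fin r → ℤ} {f : CoxRing k n}
    (hf : f ∈ grading k n d) (hfa : f ∈ irrelevantPow k n a) (h : f ≠ 0) (i : Fin r) :
    (a i : ℤ) ≤ d i := by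
  obtain ⟨e, he⟩ := ne_zero_iff.1 h
  rw [← mem_grading.1 hf e he]
  exact mem_irrelevantPow.1 hfa e he i

theorem mem_factorIdeal_pow_of_le {i : Fin r} {b : ℕ} {d : Fin r → ℤ} {f : CoxRing k n}
    (hf : f ∈ grading k n d) (h : (b : ℤ) ≤ d i) : f ∈ factorIdeal k n i ^ b :=
  mem_factorIdeal_pow.2 fun e he => by rw [mem_grading.1 hf e he]; exact h

theorem irrelevantPow_eq_top {a : Fin r → ℕ} (h : a = 0) : irrelevantPow k n a = ⊤ :=
  (Ideal.eq_top_iff_one _).2 (mem_irrelevantPow_of_le one_mem_grading (by simp [h]))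

/-- Factors are added one at a time; the n_i + 1 variables of a new factor raise the bound by n_i.
Factors outside T, where a is zero, cost nothing. -/
theorem projDimLT_irrelevantPow (a : Fin r → ℕ) (T : Finset (Fin r)) (hT : ∀ i ∉ T, a i = 0) :
    ProjDimLT (CoxRing k n) (1 + ∑ i ∈ T, n i) (irrelevantPow k n a) := by
  classical
  induction T using Finset.induction generalizing a with
  | empty =>
    rw [irrelevantPow_eq_top (funext fun i => hT i (by simp))]
    have : Module.Projective (CoxRing k n) (⊤ : Ideal (CoxRing k n)) :=
      Module.Projective.of_equiv Submodule.topEquiv.symm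
    exact projDimLT_of_projective
  | insert i T hi ih =>
    have h0 := ih (Function.update a i 0) fun j hj => by
      by_cases h : j = i
      · simp [h]
      · rw [Function.update_of_ne h]
        exact hT j (by simp [h, hj])
    -- These are the exponents allowed by all factors but i; membership does not depend on the
    -- variables of factor i.
    let U : Set (Var n →₀ ℕ) := {e | ∀ j, j ≠ i → a j ≤ ∑ l, e ⟨j, l⟩}
    have hU : IsUpperSet U := fun e e' h he j hj =>
      (he j hj).trans (Finset.sum_le_sum fun l _ => h ⟨j, l⟩)
    have hU0 : irrelevantPow k n (Function.update a i 0) = monomialIdeal k U := by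
      ext f
      rw [mem_irrelevantPow, mem_monomialIdeal hU]
      refine forall₂_congr fun e _ => ?_
      simp only [weight_apply, Nat.cast_le]
      refine ⟨fun h j hj => by simpa [hj] using h j, fun h j => ?_⟩
      by_cases hj : j = i
      · subst hj; simp
      · simpa [hj] using h j hj
    have hU1 : irrelevantPow k n a =
        monomialIdeal k (U ∩ degreeAtLeast (factorVars n i) (a i)) := by
      ext f
      rw [mem_irrelevantPow, mem_monomialIdeal (hU.inter (isUpperSet_degreeAtLeast _ _))]
      refine forall₂_congr fun e _ => ?_
      simp only [weight_apply, Nat.cast_le, Set.mem_inter_iff, degreeAtLeast, Set.mem_ofPred_eq,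
        sum_factorVars]
      refine ⟨fun h => ⟨fun j _ => h j, h i⟩, fun h j => ?_⟩
      by_cases hj : j = i
      · subst hj; exact h.2
      · exact h.1 j hj
    rw [hU0, add_comm] at h0
    have h1 := projDimLT_monomialIdeal hU h0 (factorVars n i) (fun v hv e he j hj => by
      obtain ⟨l, -, rfl⟩ := Finset.mem_map.1 hv
      refine (he j hj).trans (Finset.sum_le_sum fun l' _ => ?_)
      simp [Ne.symm hj]) (a i) (Or.inr ⟨⟨i, 0⟩, by simp [factorVars]⟩)
    rw [hU1]
    refine h1.mono ?_
    rw [card_factorVars, Finset.sum_insert hi]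
    lia

end Grading

/-! ### Dehomogenization on the charts and the ideal of Z -/

section Dehomogenization

open MvPolynomial HomogeneousLocalization

universe u

variable {k : Type u} [Field k] {r : ℕ} {n : Fin r → ℕ}

/-- The monomial `∏ i, x_{i,σ i} ^ d i`. -/
noncomputable def chartPow (k : Type u) [Field k] {r : ℕ} {n : Fin r → ℕ} (σ : Chart n)
    (d : Fin r → ℕ) : CoxRing k n :=
  ∏ i, X ⟨i, σ i⟩ ^ d i

theorem chartPow_mem (σ : Chart n) (d : Fin r → ℕ) :
    chartPow k σ d ∈ grading k n (fun i => (d i : ℤ)) := by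
  have h : IsWeightedHomogeneous (varDegree n) (chartPow k σ d)
      (∑ i, d i • varDegree n ⟨i, σ i⟩) :=
    IsWeightedHomogeneous.prod _ _ _ fun i _ => (isWeightedHomogeneous_X k _ _).pow _
  have e : (∑ i, d i • varDegree n ⟨i, σ i⟩) = fun i => (d i : ℤ) := by
    funext j
    simp [varDegree, Finset.sum_apply, Pi.single_apply]
  rw [e] at h
  exact h

theorem chartPow_const (σ : Chart n) (m : ℕ) :
    chartPow k σ (fun _ => m) = chartMonomial k n σ ^ m := by
  rw [chartPow, chartMonomial, Finset.prod_pow]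

theorem chartPow_add (σ : Chart n) (d d' : Fin r → ℕ) :
    chartPow k σ (d + d') = chartPow k σ d * chartPow k σ d' := by
  simp [chartPow, pow_add, Finset.prod_mul_distrib]

theorem chartPow_dvd (σ : Chart n) (d : Fin r → ℕ) (m : ℕ) (h : ∀ i, d i ≤ m) :
    chartPow k σ (fun i => m - d i) * chartPow k σ d = chartMonomial k n σ ^ m := by
  rw [← chartPow_add, ← chartPow_const]
  congr 1
  funext i
  exact Nat.sub_add_cancel (h i)

theorem isUnit_chartPow (σ : Chart n) (d : Fin r → ℕ) :
    IsUnit (algebraMap (CoxRing k n) (Loc k n σ) (chartPow k σ d)) := by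
  have h : IsUnit (algebraMap (CoxRing k n) (Loc k n σ) (chartMonomial k n σ ^ (∑ i, d i))) := by
    rw [map_pow]
    exact (IsLocalization.Away.algebraMap_isUnit _).pow _
  rw [← chartPow_dvd σ d _ fun i => Finset.single_le_sum (fun _ _ => Nat.zero_le _)
    (Finset.mem_univ i), map_mul] at h
  exact isUnit_of_mul_isUnit_right h

theorem isUnit_chartMonomial_pow (σ : Chart n) (m : ℕ) :
    IsUnit (algebraMap (CoxRing k n) (Loc k n σ) (chartMonomial k n σ ^ m)) := by
  rw [← chartPow_const]
  exact isUnit_chartPow σ _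

theorem val_mk_mul (σ : Chart n) (m : ℕ) (x : CoxRing k n) (hx) :
    (Away.mk (grading k n) (chartMonomial_mem k n σ) m x hx).val *
      algebraMap (CoxRing k n) (Loc k n σ) (chartMonomial k n σ ^ m) =
    algebraMap (CoxRing k n) (Loc k n σ) x := by
  rw [Away.val_mk, Localization.mk_eq_mk']
  exact IsLocalization.mk'_spec _ x
    (⟨chartMonomial k n σ ^ m, m, rfl⟩ : Submonoid.powers (chartMonomial k n σ))

theorem X_mul_chartPow (σ : Chart n) (i : Fin r) :
    chartPow k σ (fun i' => if i' = i then 0 else 1) * X ⟨i, σ i⟩ = chartMonomial k n σ ^ 1 := by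
  rw [← chartPow_const, chartPow, chartPow, ← Finset.mul_prod_erase _ _ (Finset.mem_univ i),
    ← Finset.mul_prod_erase Finset.univ (fun i => (X ⟨i, σ i⟩ : CoxRing k n) ^ 1) (Finset.mem_univ i), if_pos rfl,
    pow_zero, one_mul, pow_one, mul_comm]
  congr 1
  refine Finset.prod_congr rfl fun i' hi' => ?_
  rw [if_neg (Finset.ne_of_mem_erase hi')]

theorem X_mul_chartPow_mem (σ : Chart n) (v : Var n) :
    (X v : CoxRing k n) * chartPow k σ (fun i => if i = v.1 then 0 else 1) ∈
      grading k n (1 • fun _ => 1) := by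
  have h := grading_mul (X_mem_grading (k := k) v) (chartPow_mem (k := k) σ
    (fun i => if i = v.1 then 0 else 1))
  have e : (Pi.single v.1 1 + fun i => ((if i = v.1 then 0 else 1 : ℕ) : ℤ) : Fin r → ℤ) =
      1 • fun _ => 1 := by
    funext i
    by_cases hi : i = v.1
    · subst hi; simp
    · simp [hi]
  rwa [e] at h

/-- The dehomogenization `x_{i,j} ↦ x_{i,j} / x_{i,σ i}`. -/
noncomputable def dehom (k : Type u) [Field k] {r : ℕ} {n : Fin r → ℕ} (σ : Chart n) :
    CoxRing k n →+* ChartRing k n σ :=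
  eval₂Hom ((fromZeroRingHom (grading k n) _).comp (algebraMap k (grading k n 0)))
    fun v => Away.mk (grading k n) (chartMonomial_mem k n σ) 1 _ (X_mul_chartPow_mem σ v)

theorem val_dehom_C (σ : Chart n) (c : k) :
    (dehom k σ (C c)).val = algebraMap (CoxRing k n) (Loc k n σ) (C c) := by
  rw [dehom, eval₂Hom_C]
  rfl

theorem val_dehom_X (σ : Chart n) (v : Var n) :
    (dehom k σ (X v)).val * algebraMap (CoxRing k n) (Loc k n σ) (X ⟨v.1, σ v.1⟩) =
      algebraMap (CoxRing k n) (Loc k n σ) (X v) := by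
  have h := val_mk_mul σ 1 _ (X_mul_chartPow_mem (k := k) σ v)
  rw [dehom, eval₂Hom_X']
  rw [← X_mul_chartPow σ v.1, mul_comm (chartPow k σ _), map_mul, map_mul, ← mul_assoc] at h
  exact (isUnit_chartPow σ _).mul_left_injective h

theorem val_dehom_monomial (σ : Chart n) (e : Var n →₀ ℕ) (c : k) :
    (dehom k σ (monomial e c)).val *
      algebraMap (CoxRing k n) (Loc k n σ) (chartPow k σ fun i => ∑ j, e ⟨i, j⟩) =
    algebraMap (CoxRing k n) (Loc k n σ) (monomial e c) := by
  have h1 : chartPow k σ (fun i => ∑ j, e ⟨i, j⟩) = ∏ v : Var n, X ⟨v.1, σ v.1⟩ ^ e v := by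
    rw [chartPow, Fintype.prod_sigma]
    exact Finset.prod_congr rfl fun i _ => (Finset.prod_pow_eq_pow_sum _ _ _).symm
  rw [monomial_eq, Finsupp.prod_fintype _ _ (by simp), h1]
  change algebraMap (ChartRing k n σ) (Loc k n σ) _ * _ = _
  simp only [map_mul, map_prod, map_pow]
  rw [mul_assoc, ← Finset.prod_mul_distrib, HomogeneousLocalization.algebraMap_apply, val_dehom_C]
  congr 1
  refine Finset.prod_congr rfl fun v _ => ?_
  rw [← mul_pow, HomogeneousLocalization.algebraMap_apply, val_dehom_X]

theorem val_dehom (σ : Chart n) {d : Fin r → ℕ} {f : CoxRing k n}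
    (hf : f ∈ grading k n (fun i => (d i : ℤ))) :
    (dehom k σ f).val * algebraMap (CoxRing k n) (Loc k n σ) (chartPow k σ d) =
      algebraMap (CoxRing k n) (Loc k n σ) f := by
  conv_lhs => rw [as_sum f]
  conv_rhs => rw [as_sum f]
  change algebraMap (ChartRing k n σ) (Loc k n σ) _ * _ = _
  simp only [map_sum]
  rw [Finset.sum_mul]
  refine Finset.sum_congr rfl fun e he => ?_
  rw [← val_dehom_monomial, HomogeneousLocalization.algebraMap_apply]
  congr 3
  funext i
  have h := congrFun (mem_grading.1 hf e (mem_support_iff.1 he)) i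
  rw [weight_apply] at h
  exact_mod_cast h.symm

theorem dehom_X_chart (σ : Chart n) (i : Fin r) : dehom k σ (X ⟨i, σ i⟩) = 1 := by
  have h := val_dehom_X (k := k) σ ⟨i, σ i⟩
  have hu : IsUnit (algebraMap (CoxRing k n) (Loc k n σ) (X ⟨i, σ i⟩)) := by
    have h1 := isUnit_chartMonomial_pow (k := k) σ 1
    rw [← X_mul_chartPow σ i, map_mul] at h1
    exact isUnit_of_mul_isUnit_right h1
  apply val_injective
  rw [val_one]
  exact hu.mul_left_injective (by simpa using h)

theorem dehom_chartMonomial (σ : Chart n) : dehom k σ (chartMonomial k n σ) = 1 := by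
  simp [chartMonomial, dehom_X_chart]

theorem dehom_eq_mk (σ : Chart n) (m : ℕ) (x : CoxRing k n) (hx) :
    dehom k σ x = Away.mk (grading k n) (chartMonomial_mem k n σ) m x hx := by
  have hx' : x ∈ grading k n (fun _ => (m : ℤ)) := by
    have e : m • (fun _ => 1 : Fin r → ℤ) = fun _ => (m : ℤ) := by
      funext i
      simp
    rwa [e] at hx
  apply val_injective
  have h := val_dehom σ (d := fun _ => m) hx'
  rw [chartPow_const] at h
  exact (isUnit_chartMonomial_pow σ m).mul_left_injective (h.trans (val_mk_mul σ m x hx).symm)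

theorem dehom_surjective (σ : Chart n) : Function.Surjective (dehom k σ) := by
  intro z
  obtain ⟨m, x, hx, rfl⟩ := Away.mk_surjective (grading k n) (chartMonomial_mem k n σ) z
  exact ⟨x, dehom_eq_mk σ m x hx⟩

theorem exists_natDegree {d : Fin r → ℤ} {f : CoxRing k n} (hf : f ∈ grading k n d) (h : f ≠ 0) :
    ∃ d' : Fin r → ℕ, d = fun i => (d' i : ℤ) :=
  ⟨fun i => (d i).toNat, funext fun i => (Int.toNat_of_nonneg (nonneg_of_mem_grading hf h i)).symm⟩

namespace ClosedSubscheme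

variable (Z : ClosedSubscheme k n)

/-- The ideal of the closed subscheme `Z ∩ U_σ`, where `U_σ` is embedded in the spectrum of the
Cox ring by the equations `x_{i,σ i} = 1`. -/
noncomputable def coneIdeal (σ : Chart n) : Ideal (CoxRing k n) :=
  (Z.chartIdeal σ).comap (dehom k σ)

/-- On U_σ the line bundle 𝒪(-d) is trivialized by the inverse of ∏ x_{i,σ i}^(d_i), and that
section times f is the dehomogenization of f. -/
theorem formVanishes_iff {d : Fin r → ℤ} {f : CoxRing k n} (hf : f ∈ grading k n d) :
    Z.FormVanishes d f ↔ ∀ σ, f ∈ Z.coneIdeal σ := by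
  by_cases h0 : f = 0
  · subst h0
    refine ⟨fun _ σ => zero_mem _, fun _ σ s _ => ⟨0, zero_mem _, by simp⟩⟩
  obtain ⟨d, rfl⟩ := exists_natDegree hf h0
  refine forall_congr' fun σ => ⟨fun h => ?_, fun h s ⟨m, g, hg, hs⟩ => ?_⟩
  -- A single exponent m ≥ d_i lets the inverse of ∏ x_{i,σ i}^(d_i) be written as g / x_σ^m, the
  -- form required of a section.
  · let m := ∑ i, d i
    have hd : ∀ i, d i ≤ m := fun i => Finset.single_le_sum (fun _ _ => Nat.zero_le _)
      (Finset.mem_univ i)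
    let g := chartPow k σ (fun i => m - d i)
    have hg : g ∈ grading k n (-(fun i => (d i : ℤ)) + fun _ => (m : ℤ)) := by
      have h1 := chartPow_mem (k := k) σ (fun i => m - d i)
      have e : (fun i => ((m - d i : ℕ) : ℤ)) = -(fun i => (d i : ℤ)) + fun _ => (m : ℤ) := by
        funext i
        rw [Nat.cast_sub (hd i)]
        simp
        ring
      rwa [e] at h1
    let s : Loc k n σ := IsLocalization.mk' _ g
      (⟨chartMonomial k n σ ^ m, m, rfl⟩ : Submonoid.powers (chartMonomial k n σ))
    have hs : s * algebraMap _ _ (chartMonomial k n σ ^ m) =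
        algebraMap (CoxRing k n) (Loc k n σ) g := IsLocalization.mk'_spec _ _ _
    obtain ⟨g', hg', hval⟩ := h s ⟨m, g, hg, hs⟩
    have h2 : s * algebraMap (CoxRing k n) (Loc k n σ) (chartPow k σ d) = 1 := by
      apply (isUnit_chartPow (k := k) σ (fun i => m - d i)).mul_left_injective
      change s * _ * _ = 1 * _
      rw [mul_assoc, ← map_mul, mul_comm (chartPow k σ d), chartPow_dvd σ d m hd, hs, one_mul]
    have h3 : g' = dehom k σ f := by
      apply val_injective
      rw [hval, ← val_dehom σ hf, mul_left_comm, h2, mul_one]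
    rw [coneIdeal, Ideal.mem_comap, ← h3]
    exact hg'
  · refine ⟨dehom k σ (g * f), ?_, ?_⟩
    · rw [map_mul]
      exact Ideal.mul_mem_left _ _ h
    · have h1 := grading_mul hg hf
      rw [neg_add_eq_sub, sub_add_cancel] at h1
      have h2 := val_dehom σ (d := fun _ => m) h1
      rw [chartPow_const, map_mul (algebraMap _ _) g f, ← hs, mul_right_comm] at h2
      exact (isUnit_chartMonomial_pow σ m).mul_left_injective h2

theorem ideal_le_coneIdeal (σ : Chart n) : Z.ideal ≤ Z.coneIdeal σ := by
  rw [ideal, Ideal.span_le]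
  rintro f ⟨d, hd, hf⟩
  exact (Z.formVanishes_iff hd).1 hf σ

theorem mem_ideal_iff {d : Fin r → ℤ} {f : CoxRing k n} (hf : f ∈ grading k n d) :
    f ∈ Z.ideal ↔ ∀ σ, f ∈ Z.coneIdeal σ :=
  ⟨fun h σ => Z.ideal_le_coneIdeal σ h,
    fun h => Ideal.subset_span ⟨d, hf, (Z.formVanishes_iff hf).2 h⟩⟩

theorem isHomog_ideal : IsHomog Z.ideal :=
  IsHomog.span fun _ ⟨d, hd, _⟩ => ⟨d, hd⟩

theorem X_sub_one_mem_coneIdeal (σ : Chart n) (i : Fin r) :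
    X ⟨i, σ i⟩ - 1 ∈ Z.coneIdeal σ := by
  rw [coneIdeal, Ideal.mem_comap, map_sub, dehom_X_chart, map_one, sub_self]
  exact zero_mem _

/-- The coordinate ring of `Z ∩ U_σ`. -/
noncomputable def quotientConeIdealEquiv (σ : Chart n) :
    (CoxRing k n ⧸ Z.coneIdeal σ) ≃+* (ChartRing k n σ ⧸ Z.chartIdeal σ) :=
  (Ideal.quotEquivOfEq (by
    ext f
    rw [coneIdeal, Ideal.mem_comap, RingHom.mem_ker, RingHom.comp_apply,
      Ideal.Quotient.eq_zero_iff_mem])).trans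
    (RingHom.quotientKerEquivOfSurjective
      (f := (Ideal.Quotient.mk (Z.chartIdeal σ)).comp (dehom k σ))
      (Ideal.Quotient.mk_surjective.comp (dehom_surjective σ)))

theorem exists_coneIdeal_ne_top (hZ : Z.dim = 0) : ∃ σ, Z.coneIdeal σ ≠ ⊤ := by
  by_contra! h
  have : Z.dim = ⊥ := by
    rw [dim, iSup_eq_bot]
    intro σ
    have : Subsingleton (CoxRing k n ⧸ Z.coneIdeal σ) := Ideal.Quotient.subsingleton_iff.2 (h σ)
    rw [← ringKrullDim_eq_of_ringEquiv (Z.quotientConeIdealEquiv σ)]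
    exact ringKrullDim_eq_bot_of_subsingleton
  rw [this] at hZ
  exact absurd hZ (by simp)

/-- A finitely generated k-algebra of Krull dimension at most zero is finite over k. Later arguments
use the dimension of Z only through this and `exists_coneIdeal_ne_top`. -/
theorem finite_quotient_coneIdeal (hZ : Z.dim = 0) (σ : Chart n) :
    Module.Finite k (CoxRing k n ⧸ Z.coneIdeal σ) := by
  have h : ringKrullDim (CoxRing k n ⧸ Z.coneIdeal σ) ≤ 0 := by
    rw [ringKrullDim_eq_of_ringEquiv (Z.quotientConeIdealEquiv σ), ← hZ, dim]
    exact le_iSup (fun σ => ringKrullDim (ChartRing k n σ ⧸ Z.chartIdeal σ)) σ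
  have : Ring.KrullDimLE 0 (CoxRing k n ⧸ Z.coneIdeal σ) := by
    rw [Ring.krullDimLE_iff]
    exact_mod_cast h
  rw [Module.finite_iff_krullDimLE_zero]
  exact this

end ClosedSubscheme

end Dehomogenization

/-! ### Passing between charts -/

section Gluing

open MvPolynomial HomogeneousLocalization

universe u

variable {k : Type u} [Field k] {r : ℕ} {n : Fin r → ℕ}

theorem val_restrictLeft_dehom (σ τ : Chart n) {d : Fin r → ℕ} {f : CoxRing k n}
    (hf : f ∈ grading k n (fun i => (d i : ℤ))) :
    (restrictLeft k n σ τ (dehom k σ f)).val *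
        algebraMap (CoxRing k n) (Loc₂ k n σ τ) (chartPow k σ d) =
      algebraMap (CoxRing k n) (Loc₂ k n σ τ) f := by
  have h := congrArg (Localization.awayLift (algebraMap (CoxRing k n) (Loc₂ k n σ τ))
    (chartMonomial k n σ) (isUnit_of_dvd_unit (map_dvd _ ⟨_, rfl⟩)
      (IsLocalization.Away.algebraMap_isUnit (chartMonomial k n σ * chartMonomial k n τ))))
    (val_dehom σ hf)
  rw [map_mul] at h
  rw [restrictLeft, val_awayMap]
  simpa only [Localization.awayLift, IsLocalization.Away.lift_eq] using h

theorem val_restrictRight_dehom (σ τ : Chart n) {d : Fin r → ℕ} {f : CoxRing k n}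
    (hf : f ∈ grading k n (fun i => (d i : ℤ))) :
    (restrictRight k n σ τ (dehom k τ f)).val *
        algebraMap (CoxRing k n) (Loc₂ k n σ τ) (chartPow k τ d) =
      algebraMap (CoxRing k n) (Loc₂ k n σ τ) f := by
  have h := congrArg (Localization.awayLift (algebraMap (CoxRing k n) (Loc₂ k n σ τ))
    (chartMonomial k n τ) (isUnit_of_dvd_unit (map_dvd _ ⟨_, mul_comm _ _⟩)
      (IsLocalization.Away.algebraMap_isUnit (chartMonomial k n σ * chartMonomial k n τ))))
    (val_dehom τ hf)
  rw [map_mul] at h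
  rw [restrictRight, val_awayMap]
  simpa only [Localization.awayLift, IsLocalization.Away.lift_eq] using h

theorem isUnit_chartPow_right (σ τ : Chart n) (d : Fin r → ℕ) :
    IsUnit (algebraMap (CoxRing k n) (Loc₂ k n σ τ) (chartPow k τ d)) := by
  have h : IsUnit (algebraMap (CoxRing k n) (Loc₂ k n σ τ)
      ((chartMonomial k n σ * chartMonomial k n τ) ^ (∑ i, d i))) := by
    rw [map_pow]
    exact (IsLocalization.Away.algebraMap_isUnit _).pow _
  rw [mul_pow, ← chartPow_dvd τ d _ fun i => Finset.single_le_sum (fun _ _ => Nat.zero_le _)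
    (Finset.mem_univ i), ← mul_assoc, map_mul] at h
  exact isUnit_of_mul_isUnit_right h

theorem chartMonomial_ne_zero (σ : Chart n) : chartMonomial k n σ ≠ 0 :=
  Finset.prod_ne_zero_iff.2 fun _ _ => X_ne_zero _

theorem restrictRight_injective (σ τ : Chart n) : Function.Injective (restrictRight k n σ τ) := by
  rw [injective_iff_map_eq_zero]
  intro z hz
  obtain ⟨m, x, hx, rfl⟩ := Away.mk_surjective (grading k n) (chartMonomial_mem k n τ) z
  rw [← dehom_eq_mk] at hz ⊢
  have hx' : x ∈ grading k n (fun _ => (m : ℤ)) := by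
    have e : m • (fun _ => 1 : Fin r → ℤ) = fun _ => (m : ℤ) := by
      funext i
      simp
    rwa [e] at hx
  have h := val_restrictRight_dehom σ τ (d := fun _ => m) hx'
  rw [hz, val_zero, zero_mul] at h
  have hinj : Function.Injective (algebraMap (CoxRing k n) (Loc₂ k n σ τ)) :=
    IsLocalization.injective _ (powers_le_nonZeroDivisors_of_noZeroDivisors
      (mul_ne_zero (chartMonomial_ne_zero σ) (chartMonomial_ne_zero τ)))
  rw [hinj (h.symm.trans (map_zero _).symm), map_zero]

/-- On the overlap the two dehomogenizations of a form of degree d differ by the transition function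
∏ (x_{i,σ i} / x_{i,τ i})^(d_i). -/
theorem restrictRight_dehom_eq (σ τ : Chart n) {d : Fin r → ℕ} {f : CoxRing k n}
    (hf : f ∈ grading k n (fun i => (d i : ℤ))) :
    restrictRight k n σ τ (dehom k τ f) = restrictLeft k n σ τ (dehom k σ f) *
      restrictRight k n σ τ (dehom k τ (chartPow k σ d)) := by
  apply val_injective
  apply (isUnit_chartPow_right σ τ d).mul_left_injective
  dsimp only
  rw [val_mul, mul_assoc, val_restrictRight_dehom σ τ hf,
    val_restrictRight_dehom σ τ (chartPow_mem σ d), val_restrictLeft_dehom σ τ hf]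

/-- U_σ ∩ U_τ is the principal open subset of U_τ where the dehomogenization of x_σ is invertible,
so a power of that function clears denominators. -/
theorem exists_restrictRight_eq (σ τ : Chart n) (c : OverlapRing k n σ τ) :
    ∃ (m : ℕ) (c' : ChartRing k n τ),
      restrictRight k n σ τ (dehom k τ (chartMonomial k n σ)) ^ m * c =
        restrictRight k n σ τ c' := by
  obtain ⟨m, s, hs, rfl⟩ := Away.mk_surjective (grading k n)
    (grading_mul (chartMonomial_mem k n σ) (chartMonomial_mem k n τ)) c
  refine ⟨m, dehom k τ s, ?_⟩
  have hs' : s ∈ grading k n (fun _ => ((m + m : ℕ) : ℤ)) := by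
    have e : m • ((fun _ => 1) + fun _ => 1 : Fin r → ℤ) = fun _ => ((m + m : ℕ) : ℤ) := by
      funext i
      simp
      ring
    rwa [e] at hs
  apply val_injective
  apply (isUnit_chartPow_right σ τ (fun _ => m + m)).mul_left_injective
  dsimp only
  rw [val_restrictRight_dehom σ τ (d := fun _ => m + m) hs', val_mul, ← map_pow, ← map_pow,
    chartPow_const, pow_add, map_mul]
  have h := val_restrictRight_dehom (k := k) σ τ (d := fun _ => m)
    (f := chartMonomial k n σ ^ m) (chartMonomial_pow_mem σ m)
  rw [chartPow_const] at h
  rw [mul_mul_mul_comm, h, mul_left_comm, ← map_mul, ← mul_pow, Away.val_mk,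
    Localization.mk_eq_mk']
  exact IsLocalization.mk'_spec _ s (⟨(chartMonomial k n σ * chartMonomial k n τ) ^ m, m, rfl⟩ :
    Submonoid.powers (chartMonomial k n σ * chartMonomial k n τ))

theorem exists_mem_restrictRight_eq (σ τ : Chart n) (I : Ideal (ChartRing k n τ))
    {y : OverlapRing k n σ τ} (hy : y ∈ I.map (restrictRight k n σ τ)) :
    ∃ (m : ℕ), ∃ w ∈ I,
      restrictRight k n σ τ (dehom k τ (chartMonomial k n σ)) ^ m * y =
        restrictRight k n σ τ w := by
  induction hy using Submodule.span_induction with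
  | mem y hy =>
    obtain ⟨w, hw, rfl⟩ := hy
    exact ⟨0, w, hw, by rw [pow_zero, one_mul]⟩
  | zero => exact ⟨0, 0, zero_mem _, by rw [mul_zero, map_zero]⟩
  | add y y' _ _ h h' =>
    obtain ⟨m, w, hw, e⟩ := h
    obtain ⟨m', w', hw', e'⟩ := h'
    refine ⟨m + m', dehom k τ (chartMonomial k n σ) ^ m' * w +
      dehom k τ (chartMonomial k n σ) ^ m * w', add_mem (Ideal.mul_mem_left _ _ hw)
        (Ideal.mul_mem_left _ _ hw'), ?_⟩
    rw [map_add, map_mul, map_mul, ← e, ← e', map_pow, map_pow]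
    ring
  | smul c y _ h =>
    obtain ⟨m, w, hw, e⟩ := h
    obtain ⟨m', c', e'⟩ := exists_restrictRight_eq σ τ c
    refine ⟨m' + m, c' * w, Ideal.mul_mem_left _ _ hw, ?_⟩
    rw [map_mul, ← e, ← e', smul_eq_mul]
    ring

namespace ClosedSubscheme

variable (Z : ClosedSubscheme k n)

/-- By the agreement of the chart ideals, f vanishes on Z over the overlap. The overlap is a
principal open subset of U_τ, so a power of its defining function times f vanishes on Z over all of
U_τ. -/
theorem exists_pow_mul_mem_coneIdeal (σ τ : Chart n) {d : Fin r → ℤ} {f : CoxRing k n}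
    (hf : f ∈ grading k n d) (h : f ∈ Z.coneIdeal σ) :
    ∃ m : ℕ, chartMonomial k n σ ^ m * f ∈ Z.coneIdeal τ := by
  by_cases h0 : f = 0
  · subst h0
    exact ⟨0, by simp⟩
  obtain ⟨d, rfl⟩ := exists_natDegree hf h0
  have h1 : restrictRight k n σ τ (dehom k τ f) ∈
      (Z.chartIdeal τ).map (restrictRight k n σ τ) := by
    rw [restrictRight_dehom_eq σ τ hf, ← Z.agree]
    exact Ideal.mul_mem_right _ _ (Ideal.mem_map_of_mem _ h)
  obtain ⟨m, w, hw, e⟩ := exists_mem_restrictRight_eq σ τ _ h1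
  refine ⟨m, ?_⟩
  rw [← map_pow, ← map_mul] at e
  rw [coneIdeal, Ideal.mem_comap, map_mul, map_pow, restrictRight_injective σ τ e]
  exact hw

/-- Forms which vanish on one chart vanish everywhere after multiplication by a power of the
chart monomial. -/
theorem exists_pow_mul_mem_ideal (σ : Chart n) {d : Fin r → ℤ} {f : CoxRing k n}
    (hf : f ∈ grading k n d) (h : f ∈ Z.coneIdeal σ) :
    ∃ m : ℕ, chartMonomial k n σ ^ m * f ∈ Z.ideal := by
  choose m hm using fun τ => Z.exists_pow_mul_mem_coneIdeal σ τ hf h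
  refine ⟨∑ τ, m τ, (Z.mem_ideal_iff (grading_mul (chartMonomial_pow_mem σ _) hf)).2 fun τ => ?_⟩
  rw [← Nat.sub_add_cancel (Finset.single_le_sum (f := m) (fun _ _ => Nat.zero_le _)
    (Finset.mem_univ τ)), pow_add, mul_assoc]
  exact Ideal.mul_mem_left _ _ (hm τ)

theorem chartMonomial_sub_one_mem (σ : Chart n) (m : ℕ) :
    chartMonomial k n σ ^ m - 1 ∈ Z.coneIdeal σ := by
  rw [coneIdeal, Ideal.mem_comap, map_sub, map_pow, dehom_chartMonomial, one_pow, map_one, sub_self]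
  exact zero_mem _

end ClosedSubscheme

end Gluing

/-! ### Forms in one group of variables that are units on Z -/

section RegularForms

open MvPolynomial

universe u

variable {k : Type u} [Field k] {r : ℕ} {n : Fin r → ℕ}

theorem pow_mem_single {i : Fin r} {c : ℕ} {f : CoxRing k n}
    (hf : f ∈ grading k n (Pi.single i (c : ℤ))) (m : ℕ) :
    f ^ m ∈ grading k n (Pi.single i ((m * c : ℕ) : ℤ)) := by
  have h := grading_pow hf m
  rwa [← Pi.single_smul, nsmul_eq_mul, ← Nat.cast_mul] at h

theorem mul_mem_single {i : Fin r} {c c' : ℕ} {f g : CoxRing k n}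
    (hf : f ∈ grading k n (Pi.single i (c : ℤ))) (hg : g ∈ grading k n (Pi.single i (c' : ℤ))) :
    f * g ∈ grading k n (Pi.single i ((c + c' : ℕ) : ℤ)) := by
  have h := grading_mul hf hg
  rwa [← Pi.single_add, ← Nat.cast_add] at h

theorem X_mem_single (i : Fin r) (j : Fin (n i + 1)) :
    (X ⟨i, j⟩ : CoxRing k n) ∈ grading k n (Pi.single i ((1 : ℕ) : ℤ)) := by
  rw [Nat.cast_one]
  exact X_mem_grading _

theorem prod_mem_single {ι : Type*} (s : Finset ι) {i : Fin r} {c : ι → ℕ} {f : ι → CoxRing k n}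
    (h : ∀ j ∈ s, f j ∈ grading k n (Pi.single i (c j : ℤ))) :
    ∏ j ∈ s, f j ∈ grading k n (Pi.single i ((∑ j ∈ s, c j : ℕ) : ℤ)) := by
  classical
  induction s using Finset.induction with
  | empty => simpa using one_mem_grading
  | insert j s hj ih =>
    rw [Finset.prod_insert hj, Finset.sum_insert hj]
    exact mul_mem_single (h j (by simp)) (ih fun j' hj' => h j' (by simp [hj']))

/-- Prime avoidance by forms in the variables of one factor. -/
theorem exists_form_notMem (i : Fin r) (T : Finset (Ideal (CoxRing k n)))
    (hT : ∀ P ∈ T, P.IsPrime ∧ ∃ j, X ⟨i, j⟩ ∉ P) :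
    ∃ c : ℕ, 0 < c ∧ ∃ f ∈ grading k n (Pi.single i (c : ℤ)), ∀ P ∈ T, f ∉ P := by
  classical
  induction T using Finset.strongInduction with
  | H T ih =>
    rcases T.eq_empty_or_nonempty with rfl | ⟨Q, hQ⟩
    · exact ⟨1, one_pos, X ⟨i, 0⟩, X_mem_single i 0, by simp⟩
    have h1 : ∀ P : Ideal (CoxRing k n), ∃ (c : ℕ) (f : CoxRing k n), P ∈ T → 0 < c ∧
        f ∈ grading k n (Pi.single i (c : ℤ)) ∧ ∀ P' ∈ T.erase P, f ∉ P' := by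
      intro P
      by_cases hP : P ∈ T
      · obtain ⟨c, hc, f, hf, hfP⟩ := ih (T.erase P) (Finset.erase_ssubset hP)
          fun P' hP' => hT P' (Finset.mem_of_mem_erase hP')
        exact ⟨c, f, fun _ => ⟨hc, hf, hfP⟩⟩
      · exact ⟨0, 0, fun h => absurd h hP⟩
    choose c f hf using h1
    by_cases h2 : ∃ P ∈ T, f P ∉ P
    · obtain ⟨P, hP, hfP⟩ := h2
      refine ⟨c P, (hf P hP).1, f P, (hf P hP).2.1, fun P' hP' => ?_⟩
      by_cases h : P' = P
      · rwa [h]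
      · exact (hf P hP).2.2 P' (Finset.mem_erase.2 ⟨h, hP'⟩)
    push Not at h2
    obtain ⟨hQp, j, hj⟩ := hT Q hQ
    -- Here each f P lies in P and in no other prime of T. So a avoids Q and lies in all the others,
    -- while f Q does the opposite. The powers c Q and ca equalize degrees, and the factor x_{i,j}
    -- makes ca positive.
    have ha := mul_mem_single (X_mem_single (k := k) i j)
      (prod_mem_single (T.erase Q) fun P hP => (hf P (Finset.mem_of_mem_erase hP)).2.1)
    set a := (X ⟨i, j⟩ : CoxRing k n) * ∏ P ∈ T.erase Q, f P
    set ca := 1 + ∑ P ∈ T.erase Q, c P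
    have haQ : a ∉ Q := by
      refine hQp.mul_notMem hj fun h => ?_
      obtain ⟨P, hP, hPQ⟩ := (hQp.prod_mem_iff).1 h
      exact (hf P (Finset.mem_of_mem_erase hP)).2.2 Q
        (Finset.mem_erase.2 ⟨(Finset.ne_of_mem_erase hP).symm, hQ⟩) hPQ
    have hbQ := h2 Q hQ
    have h3 := pow_mem_single (hf Q hQ).2.1 ca
    have h4 := pow_mem_single ha (c Q)
    rw [mul_comm] at h4
    refine ⟨ca * c Q, Nat.mul_pos (by lia) (hf Q hQ).1, a ^ c Q + f Q ^ ca, add_mem h4 h3,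
      fun P hP hmem => ?_⟩
    by_cases h : P = Q
    · subst h
      exact haQ (hQp.mem_of_pow_mem _ ((Submodule.add_mem_iff_left _
        (Ideal.pow_mem_of_mem _ hbQ _ (by lia))).1 hmem))
    · have hPT : P ∈ T.erase Q := Finset.mem_erase.2 ⟨h, hP⟩
      have haP : a ∈ P := Ideal.mul_mem_left _ _
        (Ideal.mem_of_dvd _ (Finset.dvd_prod_of_mem f hPT) (h2 P hP))
      exact (hf Q hQ).2.2 P hPT ((hT P hP).1.mem_of_pow_mem _ ((Submodule.add_mem_iff_right _
        (Ideal.pow_mem_of_mem _ haP _ (hf Q hQ).1)).1 hmem))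

/-- Multiplication by x is injective on the finite-dimensional subalgebra k[x], hence surjective, so
the inverse of x is a polynomial in x. -/
theorem exists_aeval_mul_eq_one {A : Type*} [CommRing A] [Algebra k A] [Module.Finite k A] {x : A}
    (hx : IsUnit x) : ∃ q : Polynomial k, x * Polynomial.aeval x q = 1 := by
  let B := Algebra.adjoin k {x}
  let y : B := ⟨x, Algebra.self_mem_adjoin_singleton k x⟩
  have hinj : Function.Injective (LinearMap.mulLeft k y) := by
    intro b b' h
    exact Subtype.ext (hx.mul_right_injective (congrArg Subtype.val h))
  obtain ⟨b, hb⟩ := LinearMap.surjective_of_injective hinj 1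
  obtain ⟨q, hq⟩ : (b : A) ∈ (Polynomial.aeval (R := k) x).range := by
    rw [← Algebra.adjoin_singleton_eq_range_aeval]
    exact b.2
  refine ⟨q, ?_⟩
  have h := congrArg Subtype.val hb
  exact (congrArg (x * ·) hq).trans h

namespace ClosedSubscheme

variable (Z : ClosedSubscheme k n)

/-- Vanishing on Z is tested on charts, degree by degree, and a unit can be cancelled there. -/
theorem mem_ideal_of_mul_mem {d : Fin r → ℤ} {l : CoxRing k n} (hl : l ∈ grading k n d)
    (hunit : ∀ σ, IsUnit (Ideal.Quotient.mk (Z.coneIdeal σ) l)) {f : CoxRing k n}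
    (hf : l * f ∈ Z.ideal) : f ∈ Z.ideal := by
  refine mem_of_comp_mem fun d' => (Z.mem_ideal_iff (comp_mem d' f)).2 fun σ => ?_
  have h1 := Z.ideal_le_coneIdeal σ (Z.isHomog_ideal _ hf (d + d'))
  rw [comp_mul_left hl, ← Ideal.Quotient.eq_zero_iff_mem, map_mul, (hunit σ).mul_right_eq_zero,
    Ideal.Quotient.eq_zero_iff_mem] at h1
  exact h1

/-- The coordinate rings of the pieces Z ∩ U_σ are artinian, so only finitely many primes must be
avoided. None contains all variables of factor i, because x_{i,σ i} = 1 on U_σ. -/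
theorem exists_form_isUnit (hZ : Z.dim = 0) (i : Fin r) :
    ∃ c : ℕ, 0 < c ∧ ∃ l ∈ grading k n (Pi.single i (c : ℤ)),
      ∀ σ, IsUnit (Ideal.Quotient.mk (Z.coneIdeal σ) l) := by
  classical
  have hfin := Z.finite_quotient_coneIdeal hZ
  have hart : ∀ σ, IsArtinianRing (CoxRing k n ⧸ Z.coneIdeal σ) := fun σ =>
    IsArtinianRing.of_finite k _
  let t : (Σ σ : Chart n, PrimeSpectrum (CoxRing k n ⧸ Z.coneIdeal σ)) → Ideal (CoxRing k n) :=
    fun p => p.2.asIdeal.comap (Ideal.Quotient.mk _)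
  have ht : (Set.range t).Finite := Set.finite_range t
  obtain ⟨c, hc, l, hl, hlP⟩ := exists_form_notMem (k := k) i ht.toFinset (by
    intro P hP
    obtain ⟨⟨σ, p⟩, rfl⟩ := ht.mem_toFinset.1 hP
    refine ⟨p.2.comap _, σ i, fun h => p.2.ne_top ((Ideal.eq_top_iff_one _).2 ?_)⟩
    have h1 : Ideal.Quotient.mk (Z.coneIdeal σ) (X ⟨i, σ i⟩) = 1 := by
      rw [← map_one (Ideal.Quotient.mk _), Ideal.Quotient.eq]
      exact Z.X_sub_one_mem_coneIdeal σ i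
    rw [← h1]
    exact h)
  refine ⟨c, hc, l, hl, fun σ => ?_⟩
  by_contra h
  obtain ⟨M, hM, hlM⟩ := exists_max_ideal_of_mem_nonunits h
  exact hlP _ (ht.mem_toFinset.2 ⟨⟨σ, ⟨M, hM.isPrime⟩⟩, rfl⟩) hlM

theorem exists_form_mem_coneIdeal (hZ : Z.dim = 0) {i : Fin r} {c : ℕ} {l : CoxRing k n}
    (hl : l ∈ grading k n (Pi.single i (c : ℤ))) (σ : Chart n)
    (hunit : IsUnit (Ideal.Quotient.mk (Z.coneIdeal σ) l)) :
    ∃ (m : ℕ), ∃ g ∈ grading k n (Pi.single i (m : ℤ)), g ∈ Z.coneIdeal σ ∧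
      X ⟨i, σ i⟩ ^ m - g ∈ Ideal.span {l} := by
  have := Z.finite_quotient_coneIdeal hZ σ
  obtain ⟨q, hq⟩ := exists_aeval_mul_eq_one (k := k) hunit
  let e := q.natDegree
  -- This is q(l), where q(l) inverts l on Z ∩ U_σ, made homogeneous with powers of x_{i,σ i}. As
  -- that variable is 1 on U_σ, the form x_{i,σ i}^(c + ce) - l h vanishes on Z ∩ U_σ.
  let h : CoxRing k n := ∑ j ∈ Finset.range (e + 1),
    C (q.coeff j) * (l ^ j * X ⟨i, σ i⟩ ^ (c * (e - j)))
  have hh : h ∈ grading k n (Pi.single i ((c * e : ℕ) : ℤ)) := by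
    refine sum_mem fun j hj => ?_
    have h1 := mul_mem_single (pow_mem_single hl j)
      (pow_mem_single (X_mem_single (k := k) i (σ i)) (c * (e - j)))
    have h2 := grading_mul (C_mem_grading (n := n) (q.coeff j)) h1
    have h3 : j * c + c * (e - j) * 1 = c * e := by
      rw [mul_one, mul_comm j c, ← mul_add, Nat.add_sub_cancel' (by simpa using hj)]
    rwa [zero_add, h3] at h2
  have hX : Ideal.Quotient.mk (Z.coneIdeal σ) (X ⟨i, σ i⟩) = 1 := by
    rw [← map_one (Ideal.Quotient.mk _), Ideal.Quotient.eq]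
    exact Z.X_sub_one_mem_coneIdeal σ i
  refine ⟨c + c * e, X ⟨i, σ i⟩ ^ (c + c * e) - l * h, sub_mem ?_ (mul_mem_single hl hh), ?_, ?_⟩
  · have h1 := pow_mem_single (X_mem_single (k := k) i (σ i)) (c + c * e)
    rwa [mul_one] at h1
  · rw [← Ideal.Quotient.eq_zero_iff_mem, map_sub, map_pow, hX, one_pow, map_mul, sub_eq_zero, ← hq,
      Polynomial.aeval_eq_sum_range, map_sum]
    congr 1
    refine Finset.sum_congr rfl fun j _ => ?_
    rw [map_mul, map_mul, map_pow, map_pow, hX, one_pow, mul_one, Algebra.smul_def]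
    rfl
  · rw [sub_sub_cancel]
    exact Ideal.mul_mem_right _ _ (Ideal.mem_span_singleton_self l)

theorem exists_X_pow_mem (hZ : Z.dim = 0) {i : Fin r} {c : ℕ} {l : CoxRing k n}
    (hl : l ∈ grading k n (Pi.single i (c : ℤ)))
    (hunit : ∀ σ, IsUnit (Ideal.Quotient.mk (Z.coneIdeal σ) l)) (s : Fin (n i + 1)) :
    ∃ m : ℕ, X ⟨i, s⟩ ^ m ∈ Z.ideal ⊔ Ideal.span {l} := by
  classical
  choose m g hg hgσ hgl using fun σ => Z.exists_form_mem_coneIdeal hZ hl σ (hunit σ)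
  -- Multiplying over all charts with x_{i,s} inverted gives one form G that vanishes on Z over each
  -- of them and is a power of x_{i,s} modulo l.
  let T : Finset (Chart n) := Finset.univ.filter fun σ => σ i = s
  have hG := prod_mem_single T fun σ _ => hg σ
  set G := ∏ σ ∈ T, g σ
  set D := ∑ σ ∈ T, m σ
  have hGl : X ⟨i, s⟩ ^ D - G ∈ Ideal.span {l} := by
    rw [← Ideal.Quotient.eq, map_pow, map_prod, ← Finset.prod_pow_eq_pow_sum]
    refine Finset.prod_congr rfl fun σ hσ => ?_
    have h := hgl σ
    rw [(Finset.mem_filter.1 hσ).2] at h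
    rw [← map_pow]
    exact Ideal.Quotient.eq.2 h
  have h1 : ∀ τ : Chart n, ∃ M : ℕ, X ⟨i, s⟩ ^ M * G ∈ Z.coneIdeal τ := by
    intro τ
    -- Changing only the i-th choice of τ makes x_σ dehomogenize on U_τ to x_{i,s} alone, so powers
    -- of x_{i,s} suffice to extend the vanishing of G to U_τ.
    let σ : Chart n := Function.update τ i s
    have hσ : σ ∈ T := Finset.mem_filter.2 ⟨Finset.mem_univ _, Function.update_self _ _ _⟩
    have hGσ : G ∈ Z.coneIdeal σ := Ideal.mem_of_dvd _ (Finset.dvd_prod_of_mem g hσ) (hgσ σ)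
    obtain ⟨M, hM⟩ := Z.exists_pow_mul_mem_coneIdeal σ τ hG hGσ
    refine ⟨M, ?_⟩
    have h2 : dehom k τ (chartMonomial k n σ) = dehom k τ (X ⟨i, s⟩) := by
      change dehom k τ (∏ i', X ⟨i', σ i'⟩) = _
      rw [map_prod, Finset.prod_eq_single i]
      · simp [σ]
      · intro i' _ hi'
        rw [show σ i' = τ i' from Function.update_of_ne hi' _ _]
        exact dehom_X_chart τ i'
      · simp
    rw [coneIdeal, Ideal.mem_comap, map_mul, map_pow] at hM ⊢
    rwa [h2] at hM
  choose M hM using h1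
  have h2 : X ⟨i, s⟩ ^ (∑ τ, M τ) * G ∈ Z.ideal := by
    refine (Z.mem_ideal_iff (mul_mem_single (pow_mem_single (X_mem_single i s) _) hG)).2
      fun τ => ?_
    rw [← Nat.sub_add_cancel (Finset.single_le_sum (f := M) (fun _ _ => Nat.zero_le _)
      (Finset.mem_univ τ)), pow_add, mul_assoc]
    exact Ideal.mul_mem_left _ _ (hM τ)
  refine ⟨(∑ τ, M τ) + D, ?_⟩
  have h3 : (X ⟨i, s⟩ : CoxRing k n) ^ ((∑ τ, M τ) + D) =
      X ⟨i, s⟩ ^ (∑ τ, M τ) * G + X ⟨i, s⟩ ^ (∑ τ, M τ) * (X ⟨i, s⟩ ^ D - G) := by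
    rw [pow_add]
    ring
  rw [h3]
  exact add_mem (Ideal.mem_sup_left h2) (Ideal.mem_sup_right (Ideal.mul_mem_left _ _ hGl))

/-- For every factor there is a form in its variables which is a nonzerodivisor modulo the ideal
of `Z` and generates, together with this ideal, a power of the ideal of the factor. -/
theorem exists_regular_form (hZ : Z.dim = 0) (i : Fin r) :
    ∃ c : ℕ, 0 < c ∧ ∃ l ∈ grading k n (Pi.single i (c : ℤ)),
      (∀ f, l * f ∈ Z.ideal → f ∈ Z.ideal) ∧
      ∃ m : ℕ, factorIdeal k n i ^ m ≤ Z.ideal ⊔ Ideal.span {l} := by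
  obtain ⟨c, hc, l, hl, hunit⟩ := Z.exists_form_isUnit hZ i
  refine ⟨c, hc, l, hl, fun f hf => Z.mem_ideal_of_mul_mem hl hunit hf,
    Ideal.exists_pow_le_of_le_radical_of_fg ?_ (IsNoetherian.noetherian _)⟩
  rw [factorIdeal, Ideal.span_le]
  rintro _ ⟨s, rfl⟩
  exact Z.exists_X_pow_mem hZ hl hunit s

end ClosedSubscheme

end RegularForms

/-! ### Dividing truncations by regular forms -/

section UpperBound

open MvPolynomial

universe u

variable {k : Type u} [Field k] {r : ℕ} {n : Fin r → ℕ}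

theorem mul_mem_irrelevantPow {a c : Fin r → ℕ} {f b : CoxRing k n}
    (hf : f ∈ grading k n (fun i => (c i : ℤ))) (hb : b ∈ irrelevantPow k n a) :
    f * b ∈ irrelevantPow k n (a + c) := by
  refine mem_of_comp_mem fun d => ?_
  have h := comp_mul_left hf b (d - fun i => (c i : ℤ))
  rw [add_sub_cancel] at h
  rw [h]
  by_cases h0 : comp (d - fun i => (c i : ℤ)) b = 0
  · rw [h0, mul_zero]
    exact zero_mem _
  · have h1 := le_of_mem_irrelevantPow (comp_mem _ _) (isHomog_irrelevantPow a b hb _) h0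
    have h2 := grading_mul hf (comp_mem (d - fun i => (c i : ℤ)) b)
    rw [add_sub_cancel] at h2
    refine mem_irrelevantPow_of_le h2 fun i => ?_
    have := h1 i
    simp only [Pi.sub_apply] at this
    rw [Pi.add_apply, Nat.cast_add]
    linarith

/-- The ideals which occur when a truncation is divided by forms in the variables of the factors
in `T`. -/
noncomputable def truncIdeal (I : Ideal (CoxRing k n)) (a c : Fin r → ℕ) (T : Finset (Fin r)) :
    Ideal (CoxRing k n) :=
  I ⊔ T.sup fun i => irrelevantPow k n (a + Pi.single i (c i))

/-- The image of the ideal `B` in the quotient by the ideal `K`. -/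
abbrev SubQuot {R : Type u} [CommRing R] (B K : Ideal R) : Type u :=
  B ⧸ Submodule.comap B.subtype K

variable {I : Ideal (CoxRing k n)} (hI : IsHomog I) {a c : Fin r → ℕ}

theorem comp_sup_eq_zero {T : Finset (Fin r)} {d : Fin r → ℤ} (hd : ∀ i ∈ T, d i < a i + c i)
    {f : CoxRing k n} (hf : f ∈ T.sup fun i => irrelevantPow k n (a + Pi.single i (c i))) :
    comp d f = 0 := by
  classical
  induction T using Finset.induction generalizing f with
  | empty =>
    have : f = 0 := by simpa using hf
    rw [this, map_zero]
  | insert i T _ ih =>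
    rw [Finset.sup_insert] at hf
    obtain ⟨g, hg, h, hh, rfl⟩ := Submodule.mem_sup.1 hf
    rw [map_add, ih (fun j hj => hd j (Finset.mem_insert_of_mem hj)) hh, add_zero]
    by_contra h0
    have h1 := le_of_mem_irrelevantPow (comp_mem d g) (isHomog_irrelevantPow _ g hg d) h0 i
    have h2 := hd i (Finset.mem_insert_self i T)
    simp at h1
    lia

-- Argue in each degree d. If d_j ≥ a_j + c_j for some j in T, the component of b already lies in
-- B^(a + c_j e_j). Otherwise the truncation part of l b has no component in degree d + c_i e_i, as
-- i ∉ T, so l times the component of b lies in I and regularity applies.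
include hI in
theorem mem_truncIdeal_of_mul_mem {T : Finset (Fin r)} {i : Fin r} (hi : i ∉ T)
    {l : CoxRing k n} (hl : l ∈ grading k n (Pi.single i (c i : ℤ)))
    (hreg : ∀ f, l * f ∈ I → f ∈ I) {b : CoxRing k n} (hb : b ∈ irrelevantPow k n a)
    (h : l * b ∈ truncIdeal I a c T) : b ∈ truncIdeal I a c T := by
  refine mem_of_comp_mem fun d => ?_
  by_cases h0 : comp d b = 0
  · rw [h0]
    exact zero_mem _
  by_cases hd : ∃ j ∈ T, (a j + c j : ℤ) ≤ d j
  · obtain ⟨j, hj, hjd⟩ := hd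
    have h1 := le_of_mem_irrelevantPow (comp_mem d b) (isHomog_irrelevantPow _ b hb d) h0
    refine Ideal.mem_sup_right ?_
    have hle := Finset.le_sup (f := fun i => irrelevantPow k n (a + Pi.single i (c i))) hj
    refine hle ?_
    refine mem_irrelevantPow_of_le (comp_mem d b) fun i' => ?_
    by_cases hij : i' = j
    · subst hij
      simpa using hjd
    · simpa [hij] using h1 i'
  · push Not at hd
    refine Ideal.mem_sup_left (hreg _ ?_)
    rw [← comp_mul_left hl]
    obtain ⟨g, hg, u, hu, hgu⟩ := Submodule.mem_sup.1 h
    rw [← hgu, map_add, comp_sup_eq_zero (fun j hj => ?_) hu, add_zero]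
    · exact hI g hg _
    · have hji : j ≠ i := by rintro rfl; exact hi hj
      simpa [hji] using hd j hj

-- A component of w has degree at least a_i + c_i ≥ m in factor i, hence is a multiple of l modulo
-- I. The homogeneous part of the cofactor in the matching degree lies in B^a. This is where a_i
-- must be large.
include hI in
theorem exists_mul_sub_mem {i : Fin r} {l : CoxRing k n}
    (hl : l ∈ grading k n (Pi.single i (c i : ℤ))) {m : ℕ} (hm : m ≤ a i)
    (hgen : factorIdeal k n i ^ m ≤ I ⊔ Ideal.span {l}) {w : CoxRing k n}
    (hw : w ∈ irrelevantPow k n (a + Pi.single i (c i))) :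
    ∃ b ∈ irrelevantPow k n a, w - l * b ∈ I := by
  have h : ∀ d, ∃ b ∈ irrelevantPow k n a, comp d w - l * b ∈ I := by
    intro d
    by_cases h0 : comp d w = 0
    · exact ⟨0, zero_mem _, by simp [h0]⟩
    have hd := le_of_mem_irrelevantPow (comp_mem d w) (isHomog_irrelevantPow _ w hw d) h0
    have h1 : comp d w ∈ factorIdeal k n i ^ m := by
      refine mem_factorIdeal_pow_of_le (comp_mem d w) (le_trans ?_ (hd i))
      simp
      lia
    obtain ⟨g, hg, h, hh, hgh⟩ := Submodule.mem_sup.1 (hgen h1)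
    obtain ⟨q, rfl⟩ := Ideal.mem_span_singleton'.1 hh
    refine ⟨comp (d - Pi.single i (c i : ℤ)) q, mem_irrelevantPow_of_le (comp_mem _ _) fun j => ?_,
      ?_⟩
    · have := hd j
      by_cases hj : j = i
      · subst hj
        simp at this ⊢
        lia
      · simpa [hj] using this
    · have h2 := comp_mul_left hl q (d - Pi.single i (c i : ℤ))
      rw [add_sub_cancel] at h2
      have h3 : comp d w = comp d g + comp d (l * q) := by
        rw [← map_add, mul_comm l q, hgh, comp_of_mem (comp_mem d w)]
      rw [h3, h2, add_sub_cancel_right]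
      exact hI g hg d
  choose b hb hbI using h
  refine ⟨∑ d ∈ w.support.image (Finsupp.weight (varDegree n)), b d, sum_mem fun d _ => hb d, ?_⟩
  have h1 := sum_comp w
  nth_rw 1 [← h1]
  rw [Finset.mul_sum, ← Finset.sum_sub_distrib]
  exact sum_mem fun d _ => hbI d

theorem smul_residue_eq_zero {i : Fin r} {l : CoxRing k n}
    (hl : l ∈ grading k n (Pi.single i (c i : ℤ))) (hc : 0 < c i)
    (y : CoxRing k n ⧸ idealOfVars (Var n) k) : l • y = 0 := by
  obtain ⟨f, rfl⟩ := Ideal.Quotient.mk_surjective y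
  have h : l ∈ idealOfVars (Var n) k := by
    rw [mem_idealOfVars_iff]
    by_contra h0
    have h1 := hl (d := 0) h0
    rw [map_zero] at h1
    have h2 := congrFun h1 i
    simp at h2
    lia
  rw [← Ideal.Quotient.mk_eq_mk, ← Submodule.Quotient.mk_smul, Submodule.Quotient.mk_eq_zero]
  exact Ideal.mul_mem_right _ _ h

include hI in
theorem lsmul_injective_subQuot {T : Finset (Fin r)} {i : Fin r} (hi : i ∉ T)
    {l : CoxRing k n} (hl : l ∈ grading k n (Pi.single i (c i : ℤ)))
    (hreg : ∀ f, l * f ∈ I → f ∈ I) :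
    Function.Injective (LinearMap.lsmul (CoxRing k n)
      (SubQuot (irrelevantPow k n a) (truncIdeal I a c T)) l) := by
  rw [injective_iff_map_eq_zero]
  intro y hy
  obtain ⟨b, rfl⟩ := Submodule.mkQ_surjective _ y
  rw [LinearMap.lsmul_apply, ← map_smul, Submodule.mkQ_apply, Submodule.Quotient.mk_eq_zero] at hy
  rw [Submodule.mkQ_apply, Submodule.Quotient.mk_eq_zero]
  exact mem_truncIdeal_of_mul_mem hI hi hl hreg b.2 hy

theorem truncIdeal_mono {T T' : Finset (Fin r)} (h : T ⊆ T') :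
    truncIdeal I a c T ≤ truncIdeal I a c T' :=
  sup_le_sup_left (Finset.sup_mono h) _

-- Multiplication by l is injective on the quotient for T, and its cokernel is the quotient for T ∪
-- {i}: modulo I, the ideals l B^a and B^(a + c_i e_i) coincide.
include hI in
theorem extVanishesFrom_step {T : Finset (Fin r)} {i : Fin r} (hi : i ∉ T)
    {l : CoxRing k n} (hl : l ∈ grading k n (Pi.single i (c i : ℤ))) (hc : 0 < c i)
    (hreg : ∀ f, l * f ∈ I → f ∈ I) {m : ℕ} (hm : m ≤ a i)
    (hgen : factorIdeal k n i ^ m ≤ I ⊔ Ideal.span {l}) {p : ℕ}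
    (h : ExtVanishesFrom (R := CoxRing k n) (CoxRing k n ⧸ idealOfVars (Var n) k) (p + 1)
      (SubQuot (irrelevantPow k n a) (truncIdeal I a c (insert i T)))) :
    ExtVanishesFrom (R := CoxRing k n) (CoxRing k n ⧸ idealOfVars (Var n) k) p
      (SubQuot (irrelevantPow k n a) (truncIdeal I a c T)) := by
  have hle : Submodule.comap (irrelevantPow k n a).subtype (truncIdeal I a c T) ≤
      Submodule.comap (irrelevantPow k n a).subtype (truncIdeal I a c (insert i T)) :=
    Submodule.comap_mono (truncIdeal_mono (Finset.subset_insert i T))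
  refine ExtVanishesFrom.of_smul_injective (x := l) (smul_residue_eq_zero hl hc)
    (lsmul_injective_subQuot hI hi hl hreg) (g := Submodule.factor hle) (fun y => ?_)
    (Submodule.factor_surjective hle) h
  obtain ⟨b, rfl⟩ := Submodule.mkQ_surjective _ y
  rw [Submodule.mkQ_apply]
  change Submodule.Quotient.mk b = 0 ↔ _
  rw [Submodule.Quotient.mk_eq_zero]
  have hspan : truncIdeal I a c (insert i T) =
      truncIdeal I a c T ⊔ irrelevantPow k n (a + Pi.single i (c i)) := by
    rw [truncIdeal, truncIdeal, Finset.sup_insert, sup_assoc, sup_comm (irrelevantPow k n _)]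
  constructor
  · intro hb
    rw [Submodule.mem_comap, hspan] at hb
    obtain ⟨g, hg, w, hw, hgw⟩ := Submodule.mem_sup.1 hb
    obtain ⟨b', hb', hI'⟩ := exists_mul_sub_mem hI hl hm hgen hw
    refine ⟨Submodule.Quotient.mk ⟨b', hb'⟩, ?_⟩
    rw [LinearMap.lsmul_apply, ← Submodule.Quotient.mk_smul, Submodule.Quotient.eq,
      Submodule.mem_comap]
    have e : (irrelevantPow k n a).subtype (l • ⟨b', hb'⟩ - b) = -(g + (w - l * b')) := by
      rw [map_sub, ← hgw]
      simp
      ring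
    rw [e]
    exact neg_mem (add_mem hg (Ideal.mem_sup_left hI'))
  · rintro ⟨y, hy⟩
    obtain ⟨b', rfl⟩ := Submodule.mkQ_surjective _ y
    rw [LinearMap.lsmul_apply, Submodule.mkQ_apply, ← Submodule.Quotient.mk_smul,
      Submodule.Quotient.eq, Submodule.mem_comap, map_sub] at hy
    have h1 : l * (b' : CoxRing k n) ∈ truncIdeal I a c (insert i T) := by
      rw [hspan]
      refine Ideal.mem_sup_right ?_
      have h2 := mul_mem_irrelevantPow (c := Pi.single i (c i)) (f := l) ?_ b'.2
      · exact h2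
      · have e : (fun j => ((Pi.single i (c i) : Fin r → ℕ) j : ℤ)) = Pi.single i (c i : ℤ) := by
          funext j
          by_cases hj : j = i
          · subst hj; simp
          · simp [hj]
        rw [e]
        exact hl
    have h2 := sub_mem h1 (truncIdeal_mono (Finset.subset_insert i T) hy)
    simpa using h2

end UpperBound

/-! ### The bound |n| on nonvanishing Ext into the residue field -/

section UpperBound

open MvPolynomial

universe u

variable {k : Type u} [Field k] {r : ℕ} {n : Fin r → ℕ}

/-- Uses the exact sequence 0 → B/(I ∩ B) → R/(I ∩ B) → R/B → 0. -/
theorem extVanishesFrom_inf {R : Type u} [CommRing R] {I B : Ideal R} {Y : Type u}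
    [AddCommGroup Y] [Module R Y] {p : ℕ} (h : ExtVanishesFrom (R := R) Y p (SubQuot B I))
    (hB : ProjDimLT R p (R ⧸ B)) : ExtVanishesFrom (R := R) Y p (R ⧸ (I ⊓ B)) := by
  have hle : Submodule.comap B.subtype I ≤ Submodule.comap B.subtype (I ⊓ B) :=
    fun b hb => ⟨hb, b.2⟩
  refine ExtVanishesFrom.middle (f := Submodule.mapQ _ _ B.subtype hle)
    (g := Submodule.factor (inf_le_right : I ⊓ B ≤ B)) ?_ ?_
    (Submodule.factor_surjective _) h hB.extVanishesFrom
  · rw [injective_iff_map_eq_zero]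
    intro y hy
    obtain ⟨b, rfl⟩ := Submodule.Quotient.mk_surjective _ y
    rw [Submodule.mapQ_apply, Submodule.Quotient.mk_eq_zero] at hy
    exact (Submodule.Quotient.mk_eq_zero _).2 hy.1
  · intro y
    obtain ⟨b, rfl⟩ := Submodule.Quotient.mk_surjective _ y
    change Submodule.Quotient.mk b = 0 ↔ _
    rw [Submodule.Quotient.mk_eq_zero]
    constructor
    · exact fun hb => ⟨Submodule.Quotient.mk ⟨b, hb⟩, rfl⟩
    · rintro ⟨y, hy⟩
      obtain ⟨b', rfl⟩ := Submodule.Quotient.mk_surjective _ y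
      rw [Submodule.mapQ_apply, Submodule.Quotient.eq] at hy
      have h1 := sub_mem b'.2 hy.2
      simpa using h1

theorem card_var : Fintype.card (Var n) = (∑ i, n i) + r := by
  simp [Fintype.card_sigma, Finset.sum_add_distrib]

theorem X_pow_mul_mem_irrelevantPow {a : Fin r → ℕ} (v : Var n) (m : ℕ) {b : CoxRing k n}
    (hb : b ∈ irrelevantPow k n a) :
    X v ^ m * b ∈ irrelevantPow k n (a + Pi.single v.1 m) := by
  refine mul_mem_irrelevantPow ?_ hb
  have h := grading_pow (X_mem_grading (k := k) v) m
  have e : (fun j => ((Pi.single v.1 m : Fin r → ℕ) j : ℤ)) = m • varDegree n v := by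
    funext j
    by_cases hj : j = v.1
    · subst hj; simp [varDegree]
    · simp [varDegree, hj]
  rwa [e]

/-- Downward induction on T, with q counting the factors outside T other than o. When none remain,
division by l_o leaves a module on which all variables are nilpotent. This last cokernel is not
identified with a truncation, so nothing is asked of a_o. -/
theorem extVanishesFrom_subQuot {I : Ideal (CoxRing k n)} (hI : IsHomog I) {a c : Fin r → ℕ}
    {l : Fin r → CoxRing k n} {m : Fin r → ℕ} (o : Fin r) (hc : ∀ i, 0 < c i)
    (hl : ∀ i, l i ∈ grading k n (Pi.single i (c i : ℤ)))
    (hreg : ∀ i f, l i * f ∈ I → f ∈ I)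
    (hgen : ∀ i, factorIdeal k n i ^ m i ≤ I ⊔ Ideal.span {l i}) (ha : ∀ i, i ≠ o → m i ≤ a i)
    (q : ℕ) (T : Finset (Fin r)) (hT : o ∉ T) (hq : q + T.card + 1 = r) :
    ExtVanishesFrom (R := CoxRing k n) (CoxRing k n ⧸ idealOfVars (Var n) k)
      ((∑ i, n i) + 1 + T.card) (SubQuot (irrelevantPow k n a) (truncIdeal I a c T)) := by
  induction q generalizing T with
  | zero =>
    refine ExtVanishesFrom.of_smul_injective (x := l o) (smul_residue_eq_zero (hl o) (hc o))
      (lsmul_injective_subQuot hI hT (hl o) (hreg o)) (LinearMap.exact_map_mkQ_range _)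
      (Submodule.mkQ_surjective _) ?_
    have e : (∑ i, n i) + 1 + T.card + 1 = Fintype.card (Var n) + 1 := by
      rw [card_var]
      lia
    rw [e]
    refine extVanishesFrom_of_nilpotent fun v => ?_
    by_cases hv : v.1 = o
    · have h1 : (X v : CoxRing k n) ^ m o ∈ I ⊔ Ideal.span {l o} := by
        refine hgen o (Ideal.pow_mem_pow ?_ _)
        obtain ⟨i, j⟩ := v
        dsimp only at hv
        subst hv
        exact Ideal.subset_span ⟨j, rfl⟩
      obtain ⟨g, hg, h, hh, hgh⟩ := Submodule.mem_sup.1 h1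
      obtain ⟨w, rfl⟩ := Ideal.mem_span_singleton'.1 hh
      refine ⟨m o, fun y => ?_⟩
      obtain ⟨y, rfl⟩ := Submodule.mkQ_surjective _ y
      obtain ⟨b, rfl⟩ := Submodule.mkQ_surjective _ y
      rw [← map_smul, Submodule.mkQ_apply, Submodule.Quotient.mk_eq_zero]
      refine ⟨w • Submodule.mkQ _ b, ?_⟩
      rw [LinearMap.lsmul_apply, ← map_smul, ← map_smul, ← map_smul, ← sub_eq_zero, ← map_sub,
        Submodule.mkQ_apply, Submodule.Quotient.mk_eq_zero, Submodule.mem_comap]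
      refine Ideal.mem_sup_left ?_
      have e : (irrelevantPow k n a).subtype (l o • w • b - (X v : CoxRing k n) ^ m o • b) =
          -(g * b) := by
        rw [← hgh]
        simp
        ring
      rw [e]
      exact neg_mem (Ideal.mul_mem_right _ _ hg)
    -- The other variables belong to factors in T, and x_v^(c_i) maps B^a into B^(a + c_i e_i), one
    -- of the ideals divided out.
    · have hvT : v.1 ∈ T := by
        have h1 : insert o T = Finset.univ := by
          rw [← Finset.card_eq_iff_eq_univ, Finset.card_insert_of_notMem hT, Fintype.card_fin]
          lia
        have h2 := h1 ▸ Finset.mem_univ v.1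
        exact (Finset.mem_insert.1 h2).resolve_left hv
      refine ⟨c v.1, fun y => ?_⟩
      obtain ⟨y, rfl⟩ := Submodule.mkQ_surjective _ y
      obtain ⟨b, rfl⟩ := Submodule.mkQ_surjective _ y
      rw [← map_smul, ← map_smul]
      have h0 : Submodule.mkQ (Submodule.comap (irrelevantPow k n a).subtype
          (truncIdeal I a c T)) ((X v : CoxRing k n) ^ c v.1 • b) = 0 := by
        rw [Submodule.mkQ_apply, Submodule.Quotient.mk_eq_zero, Submodule.mem_comap]
        refine Ideal.mem_sup_right ?_
        have hle := Finset.le_sup (f := fun i => irrelevantPow k n (a + Pi.single i (c i))) hvT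
        exact hle (X_pow_mul_mem_irrelevantPow v (c v.1) b.2)
      rw [h0, map_zero]
  | succ q ih =>
    have h1 : insert o T ≠ Finset.univ := by
      rw [Ne, ← Finset.card_eq_iff_eq_univ, Finset.card_insert_of_notMem hT, Fintype.card_fin]
      lia
    obtain ⟨i, hi⟩ : ∃ i, i ∉ insert o T := by
      by_contra! h
      exact h1 (Finset.eq_univ_iff_forall.2 h)
    rw [Finset.mem_insert, not_or] at hi
    refine extVanishesFrom_step hI hi.2 (hl i) (hc i) (hreg i) (ha i hi.1) (hgen i) ?_
    have h2 := ih (insert i T) (by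
      rw [Finset.mem_insert, not_or]; exact ⟨fun h => hi.1 h.symm, hT⟩)
      (by rw [Finset.card_insert_of_notMem hi.2]; lia)
    rwa [Finset.card_insert_of_notMem hi.2] at h2

/-- As a_o = 0, factor o contributes nothing to the projective dimension of B^a; n_o ≥ 1 absorbs the
increase by one from B^a to S/B^a. -/
theorem projDimLT_quotient_irrelevantPow {a : Fin r → ℕ} {o : Fin r} (ho : a o = 0)
    (hn : r = 1 ∨ 1 ≤ n o) :
    ProjDimLT (CoxRing k n) ((∑ i, n i) + 1) (CoxRing k n ⧸ irrelevantPow k n a) := by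
  rcases hn with rfl | hn
  · have h : a = 0 := by
      funext i
      rw [Subsingleton.elim i o, ho, Pi.zero_apply]
    have : Subsingleton (CoxRing k n ⧸ irrelevantPow k n a) := by
      rw [Ideal.Quotient.subsingleton_iff, irrelevantPow_eq_top h]
    exact projDimLT_of_subsingleton _
  · have h := projDimLT_irrelevantPow (k := k) (n := n) a (Finset.univ.erase o) fun i hi => by
      have : i = o := by simpa using hi
      rw [this, ho]
    rw [add_comm] at h
    refine (projDimLT_quotient h).mono ?_
    have := Finset.add_sum_erase Finset.univ n (Finset.mem_univ o)
    lia

theorem ClosedSubscheme.exists_extVanishesFrom (Z : ClosedSubscheme k n) (hZ : Z.dim = 0)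
    {o : Fin r} (hn : r = 1 ∨ 1 ≤ n o) :
    ∃ N : ℕ, ∀ a : Fin r → ℕ, a o = 0 → (∀ i, i ≠ o → N ≤ a i) →
      ExtVanishesFrom (R := CoxRing k n) (CoxRing k n ⧸ idealOfVars (Var n) k)
        ((∑ i, n i) + 1) (CoxRing k n ⧸ (Z.ideal ⊓ irrelevantPow k n a)) := by
  choose c hc l hl hreg m hgen using Z.exists_regular_form hZ
  -- The sum serves as a common upper bound for the exponents m i.
  refine ⟨∑ i, m i, fun a ho ha => ?_⟩
  refine extVanishesFrom_inf ?_ (projDimLT_quotient_irrelevantPow ho hn)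
  have h := extVanishesFrom_subQuot Z.isHomog_ideal (a := a) o hc hl hreg hgen
    (fun i hi => le_trans (Finset.single_le_sum (f := m) (fun _ _ => Nat.zero_le _)
      (Finset.mem_univ i)) (ha i hi)) (r - 1) ∅ (Finset.notMem_empty o)
    (by have := o.pos; simp; lia)
  rw [Finset.card_empty, add_zero] at h
  rwa [truncIdeal, Finset.sup_empty, sup_bot_eq] at h

end UpperBound

/-! ### A regular sequence on a chart meeting Z -/

section LowerBound

universe u

/-- Modulo I the polynomial f remains monic, hence a nonzerodivisor. -/
theorem mem_map_C_of_monic_mul_mem {R : Type*} [CommRing R] {I : Ideal R} {f g : Polynomial R}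
    (hf : f.Monic) (h : f * g ∈ I.map Polynomial.C) : g ∈ I.map Polynomial.C := by
  have key : ∀ q : Polynomial R,
      q ∈ I.map Polynomial.C ↔ q.map (Ideal.Quotient.mk I) = 0 := by
    intro q
    rw [Ideal.mem_map_C_iff, Polynomial.ext_iff]
    simp only [Polynomial.coeff_map, Polynomial.coeff_zero, Ideal.Quotient.eq_zero_iff_mem]
  rw [key, Polynomial.map_mul, (hf.map _).mul_right_eq_zero_iff, ← key] at h
  exact h

open MvPolynomial

/-- A multivariate polynomial as a polynomial in the variable `v`. -/
noncomputable def asPolynomial {σ R : Type*} [CommRing R] [DecidableEq σ] (v : σ) :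
    MvPolynomial σ R →ₐ[R] Polynomial (MvPolynomial σ R) :=
  aeval fun w => if w = v then Polynomial.X else Polynomial.C (X w)

theorem eval_asPolynomial {σ R : Type*} [CommRing R] [DecidableEq σ] (v : σ)
    (f : MvPolynomial σ R) : (asPolynomial v f).eval (X v) = f := by
  have h : ((Polynomial.aeval (X v : MvPolynomial σ R)).restrictScalars R).comp (asPolynomial v) =
      AlgHom.id R _ := by
    ext w
    by_cases hw : w = v
    · subst hw
      simp [asPolynomial]
    · simp [asPolynomial, hw]
  have h1 := AlgHom.congr_fun h f
  rwa [AlgHom.comp_apply, AlgHom.restrictScalars_apply, Polynomial.coe_aeval_eq_eval] at h1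

/-- Passing to polynomials in x_v turns the generators s into constants, so a monic p can be
cancelled; evaluation at x_v returns to the original ring. -/
theorem mem_of_mul_mem_of_monic {σ R : Type*} [CommRing R] [DecidableEq σ] {v : σ}
    {p : MvPolynomial σ R} (hp : (asPolynomial v p).Monic) {s : Set (MvPolynomial σ R)}
    (hs : ∀ q ∈ s, asPolynomial v q = Polynomial.C q) {f : MvPolynomial σ R}
    (h : p * f ∈ Ideal.span s) : f ∈ Ideal.span s := by
  have h1 : asPolynomial v p * asPolynomial v f ∈ (Ideal.span s).map Polynomial.C := by
    rw [← map_mul]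
    refine Ideal.map_le_iff_le_comap.2 ?_ (Ideal.mem_map_of_mem (asPolynomial v) h)
    rw [Ideal.span_le]
    intro q hq
    rw [SetLike.mem_coe, Ideal.mem_comap, hs q hq]
    exact Ideal.mem_map_of_mem _ (Ideal.subset_span hq)
  have h2 := Ideal.mem_map_of_mem (Polynomial.evalRingHom (X v))
    (mem_map_C_of_monic_mul_mem hp h1)
  rw [Ideal.map_map, Polynomial.coe_evalRingHom, eval_asPolynomial] at h2
  have h3 : (Polynomial.evalRingHom (X v : MvPolynomial σ R)).comp Polynomial.C =
      RingHom.id _ := by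
    ext <;> simp
  rwa [h3, Ideal.map_id] at h2

/-- Each p v is monic in its own variable, and the other members of the sequence do not involve that
variable. -/
theorem isWeaklyRegular_of_monic {σ R : Type*} [CommRing R] [DecidableEq σ] {L : List σ}
    (hL : L.Nodup) {p : σ → MvPolynomial σ R} (hp : ∀ v ∈ L, (asPolynomial v (p v)).Monic)
    (hpC : ∀ v ∈ L, ∀ w ∈ L, w ≠ v → asPolynomial v (p w) = Polynomial.C (p w)) :
    RingTheory.Sequence.IsWeaklyRegular (MvPolynomial σ R) (L.map p) := by
  rw [RingTheory.Sequence.isWeaklyRegular_iff]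
  intro i hi
  rw [List.length_map] at hi
  refine IsSMulRegular.of_right_eq_zero_of_smul fun y hy => ?_
  obtain ⟨f, rfl⟩ := Submodule.Quotient.mk_surjective _ y
  rw [← Submodule.Quotient.mk_smul, Submodule.Quotient.mk_eq_zero] at hy
  rw [Submodule.Quotient.mk_eq_zero]
  rw [smul_eq_mul, Ideal.mul_top] at hy ⊢
  rw [List.getElem_map, smul_eq_mul] at hy
  refine mem_of_mul_mem_of_monic (hp _ (List.getElem_mem hi)) (fun q hq => ?_) hy
  rw [← List.map_take] at hq
  obtain ⟨w, hw, rfl⟩ := List.mem_map.1 hq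
  obtain ⟨j, hj, rfl⟩ := List.getElem_of_mem hw
  rw [List.length_take] at hj
  refine hpC _ (List.getElem_mem hi) _ (List.mem_of_mem_take hw) fun h => ?_
  rw [List.getElem_take] at h
  have := (hL.getElem_inj_iff).1 h
  lia

variable {k : Type u} [Field k] {r : ℕ} {n : Fin r → ℕ}

/-- The homogenization of a univariate polynomial with the variables `x_v` and `x_w`. -/
noncomputable def homogenization (v w : Var n) (P : Polynomial k) : CoxRing k n :=
  ((P.map (C : k →+* CoxRing k n)).scaleRoots (X w)).eval (X v)

theorem homogenization_eq_sum (v w : Var n) (P : Polynomial k) :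
    homogenization v w P = ∑ i ∈ Finset.range (P.natDegree + 1),
      C (P.coeff i) * X w ^ (P.natDegree - i) * X v ^ i := by
  rw [homogenization, Polynomial.eval_eq_sum_range, Polynomial.natDegree_scaleRoots,
    Polynomial.natDegree_map]
  simp only [Polynomial.coeff_scaleRoots, Polynomial.coeff_map, Polynomial.natDegree_map]

theorem homogenization_mem_grading {i : Fin r} (j j' : Fin (n i + 1)) (P : Polynomial k) :
    homogenization ⟨i, j⟩ ⟨i, j'⟩ P ∈ grading k n (Pi.single i (P.natDegree : ℤ)) := by
  rw [homogenization_eq_sum]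
  refine sum_mem fun l hl => ?_
  have h1 := mul_mem_single (pow_mem_single (X_mem_single (k := k) i j') (P.natDegree - l))
    (pow_mem_single (X_mem_single (k := k) i j) l)
  have h2 := grading_mul (C_mem_grading (n := n) (P.coeff l)) h1
  rw [mul_one, mul_one, Nat.sub_add_cancel (by simpa [Nat.lt_succ_iff] using hl), zero_add,
    ← mul_assoc] at h2
  exact h2

theorem asPolynomial_homogenization {v w : Var n} (hvw : w ≠ v) (P : Polynomial k) :
    asPolynomial v (homogenization v w P) = (P.map (C : k →+* CoxRing k n)).scaleRoots (X w) := by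
  rw [homogenization_eq_sum, Polynomial.as_sum_range_C_mul_X_pow
    ((P.map (C : k →+* CoxRing k n)).scaleRoots (X w)), map_sum, Polynomial.natDegree_scaleRoots,
    Polynomial.natDegree_map]
  refine Finset.sum_congr rfl fun i _ => ?_
  rw [Polynomial.coeff_scaleRoots, Polynomial.coeff_map, Polynomial.natDegree_map]
  simp [asPolynomial, hvw, Polynomial.algebraMap_apply, algebraMap_eq]

theorem asPolynomial_homogenization_of_ne {v w u : Var n} (hv : v ≠ u) (hw : w ≠ u)
    (P : Polynomial k) :
    asPolynomial u (homogenization v w P) = Polynomial.C (homogenization v w P) := by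
  rw [homogenization_eq_sum, map_sum, map_sum]
  refine Finset.sum_congr rfl fun i _ => ?_
  simp [asPolynomial, hv, hw, Polynomial.algebraMap_apply, algebraMap_eq]

/-- The variables which are not inverted on a chart. -/
def affineVars (σ : Chart n) : Finset (Var n) :=
  Finset.univ.sigma fun i => Finset.univ.erase (σ i)

theorem mem_affineVars {σ : Chart n} {v : Var n} : v ∈ affineVars σ ↔ v.2 ≠ σ v.1 := by
  simp [affineVars]

theorem card_affineVars (σ : Chart n) : (affineVars σ).card = ∑ i, n i := by
  simp [affineVars, Finset.card_sigma]

theorem isWeaklyRegular_pi {R : Type u} [CommRing R] {M : Type u} [AddCommGroup M] [Module R M]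
    {rs : List R} (h : RingTheory.Sequence.IsWeaklyRegular M rs) (d : ℕ) :
    RingTheory.Sequence.IsWeaklyRegular (Fin d → M) rs :=
  ((TensorProduct.piScalarRight R R M (Fin d)).isWeaklyRegular_congr rs).1
    (h.isWeaklyRegular_rTensor (M₂ := Fin d → R))

theorem chartMonomial_pow_mem_irrelevantPow (σ : Chart n) (a : Fin r → ℕ) :
    chartMonomial k n σ ^ (∑ i, a i) ∈ irrelevantPow k n a :=
  mem_irrelevantPow_of_le (chartMonomial_pow_mem σ _) fun i =>
    Nat.cast_le.2 (Finset.single_le_sum (f := a) (fun _ _ => Nat.zero_le _) (Finset.mem_univ i))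

namespace ClosedSubscheme

variable (Z : ClosedSubscheme k n)

/-- The coordinate ring of Z ∩ U_σ is finite over k, so x_v satisfies a monic equation on it;
homogenizing with x_{i,σ i} changes nothing there since that variable is 1. -/
theorem exists_monic_form (hZ : Z.dim = 0) {σ : Chart n} (hσ : Z.coneIdeal σ ≠ ⊤) (v : Var n) :
    ∃ P : Polynomial k, P.Monic ∧ homogenization v ⟨v.1, σ v.1⟩ P ∈ Z.coneIdeal σ := by
  have := Z.finite_quotient_coneIdeal hZ σ
  have : Nontrivial (CoxRing k n ⧸ Z.coneIdeal σ) := Ideal.Quotient.nontrivial_iff.2 hσ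
  obtain ⟨P, hP, h⟩ := Algebra.IsIntegral.isIntegral (R := k)
    (Ideal.Quotient.mk (Z.coneIdeal σ) (X v))
  refine ⟨P, hP, ?_⟩
  have hX : Ideal.Quotient.mk (Z.coneIdeal σ) (X ⟨v.1, σ v.1⟩) = 1 :=
    (Ideal.Quotient.eq.2 (Z.X_sub_one_mem_coneIdeal σ v.1)).trans (map_one _)
  rw [← Ideal.Quotient.eq_zero_iff_mem, homogenization_eq_sum, map_sum, ← h,
    Polynomial.eval₂_eq_sum_range]
  refine Finset.sum_congr rfl fun i _ => ?_
  rw [map_mul, map_mul, map_pow, map_pow, hX, one_pow, mul_one]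
  rfl

theorem not_projDimLT (hZ : Z.dim = 0) (a : Fin r → ℕ) :
    ¬ ProjDimLT (CoxRing k n) (∑ i, n i) (CoxRing k n ⧸ (Z.ideal ⊓ irrelevantPow k n a)) := by
  intro hM
  obtain ⟨σ, hσ⟩ := Z.exists_coneIdeal_ne_top hZ
  choose P hP hPσ using Z.exists_monic_form hZ hσ
  have h1 : ∀ v : Var n, ∃ m : ℕ,
      chartMonomial k n σ ^ m * homogenization v ⟨v.1, σ v.1⟩ (P v) ∈ Z.ideal := fun v =>
    Z.exists_pow_mul_mem_ideal σ (homogenization_mem_grading v.2 (σ v.1) (P v)) (hPσ v)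
  choose m hm using h1
  -- The first summand moves the product into B^a, the second into I.
  set N := (∑ i, a i) + ∑ v, m v
  have hJ : ∀ v, chartMonomial k n σ ^ N * homogenization v ⟨v.1, σ v.1⟩ (P v) ∈
      Z.ideal ⊓ irrelevantPow k n a := by
    intro v
    refine ⟨?_, ?_⟩
    · have h2 : m v ≤ N := le_trans (Finset.single_le_sum (f := m) (fun _ _ => Nat.zero_le _)
        (Finset.mem_univ v)) (Nat.le_add_left _ _)
      rw [← Nat.sub_add_cancel h2, pow_add, mul_assoc]
      exact Ideal.mul_mem_left _ _ (hm v)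
    · rw [pow_add]
      exact Ideal.mul_mem_right _ _ (Ideal.mul_mem_right _ _ (chartMonomial_pow_mem_irrelevantPow σ a))
  have hreg : RingTheory.Sequence.IsWeaklyRegular (CoxRing k n)
      ((affineVars σ).toList.map fun v => homogenization v ⟨v.1, σ v.1⟩ (P v)) := by
    have hne : ∀ v ∈ (affineVars σ).toList, ∀ w : Var n, (⟨w.1, σ w.1⟩ : Var n) ≠ v := by
      rintro v hv w rfl
      exact mem_affineVars.1 (Finset.mem_toList.1 hv) rfl
    refine isWeaklyRegular_of_monic (Finset.nodup_toList _) (fun v hv => ?_)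
      fun v hv w hw hvw => ?_
    · rw [asPolynomial_homogenization (hne v hv v), Polynomial.monic_scaleRoots_iff]
      exact (hP v).map _
    · exact asPolynomial_homogenization_of_ne hvw (hne v hv w) _
  have hregLoc : RingTheory.Sequence.IsWeaklyRegular (Loc k n σ)
      ((affineVars σ).toList.map fun v => homogenization v ⟨v.1, σ v.1⟩ (P v)) :=
    (RingTheory.Sequence.isWeaklyRegular_map_algebraMap_iff (Loc k n σ) (Loc k n σ) _).1
      (hreg.of_isLocalization (Loc k n σ) (Submonoid.powers (chartMonomial k n σ)))
  have hbij : ∀ d : ℕ, Function.Bijective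
      (LinearMap.lsmul (CoxRing k n) (Fin d → Loc k n σ) (chartMonomial k n σ ^ N)) := by
    intro d
    obtain ⟨w, hw⟩ := isUnit_chartMonomial_pow (k := k) σ N
    have h : ∀ y : Fin d → Loc k n σ, chartMonomial k n σ ^ N • y = w • y := by
      intro y
      rw [← algebraMap_smul (Loc k n σ), ← hw]
      rfl
    refine ⟨fun y y' hy => ?_, fun y => ⟨w⁻¹ • y, ?_⟩⟩
    · simpa [h] using hy
    · simp [h]
  let J := (Z.ideal ⊓ irrelevantPow k n a).map (algebraMap (CoxRing k n) (Loc k n σ))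
  -- This is the localization map of M on the chart; the vanishing of Ext forces it to be zero.
  let φ : (CoxRing k n ⧸ (Z.ideal ⊓ irrelevantPow k n a)) →ₗ[CoxRing k n] (Loc k n σ ⧸ J) :=
    Submodule.liftQ _ (Algebra.linearMap (CoxRing k n) (Loc k n σ ⧸ J)) fun f hf => by
      rw [LinearMap.mem_ker]
      exact Ideal.Quotient.eq_zero_iff_mem.2 (Ideal.mem_map_of_mem _ hf)
  have hφ : φ = 0 := by
    refine linearMap_eq_zero_of_ext_eq_zero hM (Loc k n σ) (fun i hi d => ?_) φ
    refine ext_eq_zero_of_isWeaklyRegular (chartMonomial k n σ ^ N) _ _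
      (isWeaklyRegular_pi hregLoc d) (hbij d) (fun q hq y => ?_) i ?_
    · obtain ⟨v, _, rfl⟩ := List.mem_map.1 hq
      obtain ⟨f, rfl⟩ := Submodule.Quotient.mk_surjective _ y
      rw [← Submodule.Quotient.mk_smul, Submodule.Quotient.mk_eq_zero]
      exact Ideal.mul_mem_right _ _ (hJ v)
    · rwa [List.length_map, Finset.length_toList, card_affineVars]
  have h2 : algebraMap (CoxRing k n) (Loc k n σ) 1 ∈ J := by
    have h3 := LinearMap.congr_fun hφ (Submodule.Quotient.mk 1)
    exact Ideal.Quotient.eq_zero_iff_mem.1 h3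
  obtain ⟨_, ⟨l, rfl⟩, hl⟩ := (IsLocalization.algebraMap_mem_map_algebraMap_iff
    (Submonoid.powers (chartMonomial k n σ)) _ _ _).1 h2
  rw [mul_one] at hl
  -- Now x_σ^l lies in I, while x_σ = 1 on U_σ, so Z would miss this chart.
  refine hσ ((Ideal.eq_top_iff_one _).2 ?_)
  have h3 := sub_mem (Z.ideal_le_coneIdeal σ hl.1) (Z.chartMonomial_sub_one_mem σ l)
  rwa [sub_sub_cancel] at h3

end ClosedSubscheme

end LowerBound

/-! ### Minimal graded free resolutions -/

section Existence

open MvPolynomial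

universe u

variable {k : Type u} [Field k] {r : ℕ} {n : Fin r → ℕ}

theorem comp_eq_zero_of_notMem {f : CoxRing k n} {d : Fin r → ℤ}
    (h : d ∉ f.support.image (Finsupp.weight (varDegree n))) : comp d f = 0 := by
  rw [← sum_comp f, map_sum]
  refine Finset.sum_eq_zero fun e he => comp_of_mem_of_ne (comp_mem e f) ?_
  rintro rfl
  exact h he

theorem comp_zero_eq_C (f : CoxRing k n) : comp 0 f = C (constantCoeff f) := by
  classical
  ext e
  rw [coeff_weightedHomogeneousComponent, coeff_C, constantCoeff_eq]
  by_cases h0 : 0 = e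
  · rw [if_pos h0, ← h0, map_zero, if_pos rfl]
  · rw [if_neg h0, if_neg fun h => h0 (Finsupp.ext fun v => ?_)]
    have h1 := congrFun h v.1
    rw [weight_apply, Pi.zero_apply, Nat.cast_eq_zero, Finset.sum_eq_zero_iff] at h1
    exact (h1 v.2 (Finset.mem_univ _)).symm

/-- The component of degree `d` of an element of the graded free module with basis elements of
degrees `deg`. -/
noncomputable def vcomp {t : ℕ} (deg : Fin t → Fin r → ℤ) (d : Fin r → ℤ)
    (v : Fin t → CoxRing k n) : Fin t → CoxRing k n := fun b => comp (d - deg b) (v b)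

theorem sum_vcomp {t : ℕ} (deg : Fin t → Fin r → ℤ) (v : Fin t → CoxRing k n) :
    ∃ D : Finset (Fin r → ℤ), ∑ d ∈ D, vcomp deg d v = v := by
  classical
  refine ⟨Finset.univ.biUnion fun b =>
    ((v b).support.image (Finsupp.weight (varDegree n))).image (· + deg b), ?_⟩
  funext b
  rw [Finset.sum_apply]
  conv_rhs => rw [← sum_comp (v b)]
  have h := Finset.sum_image (s := (v b).support.image (Finsupp.weight (varDegree n)))
    (g := (· + deg b)) (f := fun d => vcomp deg d v b) fun x _ y _ h => add_right_cancel h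
  simp only [vcomp, add_sub_cancel_right] at h
  rw [← h]
  refine (Finset.sum_subset (Finset.subset_biUnion_of_mem (fun b =>
    ((v b).support.image (Finsupp.weight (varDegree n))).image (· + deg b))
      (Finset.mem_univ b)) fun d _ hd => ?_).symm
  refine comp_eq_zero_of_notMem fun h' => hd ?_
  exact Finset.mem_image.2 ⟨_, h', sub_add_cancel _ _⟩

/-- A homogeneous submodule of a graded free module. -/
def IsHomogSubmodule {t : ℕ} (deg : Fin t → Fin r → ℤ)
    (K : Submodule (CoxRing k n) (Fin t → CoxRing k n)) : Prop :=
  ∀ v ∈ K, ∀ d, vcomp deg d v ∈ K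

theorem IsHomogSubmodule.exists_minimal_generators {t : ℕ} {deg : Fin t → Fin r → ℤ}
    {K : Submodule (CoxRing k n) (Fin t → CoxRing k n)} (hK : IsHomogSubmodule deg K) :
    ∃ (s : ℕ) (g : Matrix (Fin t) (Fin s) (CoxRing k n)) (e : Fin s → Fin r → ℤ),
      (∀ b q, g b q ∈ grading k n (e q - deg b)) ∧ LinearMap.range g.mulVecLin = K ∧
      ∀ q, g.col q ∉ Submodule.span (CoxRing k n) (g.col '' {q}ᶜ) := by
  classical
  let H : Set (Fin t → CoxRing k n) := {v | v ∈ K ∧ ∃ d, ∀ b, v b ∈ grading k n (d - deg b)}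
  have hH : Submodule.span (CoxRing k n) H = K := by
    refine le_antisymm (Submodule.span_le.2 fun v hv => hv.1) fun v hv => ?_
    obtain ⟨D, hD⟩ := sum_vcomp deg v
    rw [← hD]
    exact sum_mem fun d _ => Submodule.subset_span ⟨hK v hv d, d, fun b => comp_mem _ _⟩
  obtain ⟨T₀, hT₀, hT₀K⟩ := (Submodule.fg_span_iff_fg_span_finset_subset H).1
    (IsNoetherian.noetherian (R := CoxRing k n) _)
  -- An inclusion-minimal finite set of homogeneous generators: no generator lies in the span of the
  -- others.
  obtain ⟨T, hT⟩ := exists_minimal_of_wellFoundedLT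
    (fun T : Finset (Fin t → CoxRing k n) => ↑T ⊆ H ∧ Submodule.span (CoxRing k n) ↑T = K)
    ⟨T₀, hT₀, by rw [← hT₀K, hH]⟩
  choose e he using fun q : Fin T.card => (hT.1.1 (T.equivFin.symm q).2).2
  refine ⟨T.card, Matrix.of fun b q => (T.equivFin.symm q : Fin t → CoxRing k n) b, e,
    fun b q => he q b, ?_, fun q hq => ?_⟩
  · rw [Matrix.range_mulVecLin, ← hT.1.2]
    congr 1
    ext v
    constructor
    · rintro ⟨q, rfl⟩
      exact (T.equivFin.symm q).2
    · intro hv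
      exact ⟨T.equivFin ⟨v, hv⟩, by
        change ((T.equivFin.symm (T.equivFin ⟨v, hv⟩) : T) : Fin t → CoxRing k n) = v
        rw [Equiv.symm_apply_apply]⟩
  · set x := T.equivFin.symm q
    have hx : (x : Fin t → CoxRing k n) ∈
        Submodule.span (CoxRing k n) (↑(T.erase x) : Set (Fin t → CoxRing k n)) := by
      refine Submodule.span_mono ?_ hq
      rintro _ ⟨q', hq', rfl⟩
      refine Finset.mem_coe.2 (Finset.mem_erase.2 ⟨fun h => hq' ?_, (T.equivFin.symm q').2⟩)
      exact T.equivFin.symm.injective (Subtype.ext h)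
    have h1 : T ⊆ T.erase x := hT.2 ⟨fun v hv => hT.1.1 (Finset.mem_of_mem_erase hv), by
      rw [← hT.1.2]
      refine le_antisymm (Submodule.span_mono (Finset.erase_subset _ _)) ?_
      rw [Submodule.span_le]
      intro v hv
      by_cases hvx : v = x
      · rw [hvx]
        exact hx
      · exact Submodule.subset_span (Finset.mem_erase.2 ⟨hvx, hv⟩)⟩ (Finset.erase_subset _ _)
    exact Finset.notMem_erase _ _ (h1 x.2)

theorem vcomp_mulVec {s t : ℕ} {deg : Fin t → Fin r → ℤ} {e : Fin s → Fin r → ℤ}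
    {g : Matrix (Fin t) (Fin s) (CoxRing k n)} (hg : ∀ b q, g b q ∈ grading k n (e q - deg b))
    (c : Fin s → CoxRing k n) (d : Fin r → ℤ) :
    vcomp deg d (g.mulVec c) = g.mulVec (vcomp e d c) := by
  funext b
  rw [vcomp, Matrix.mulVec, dotProduct, map_sum, Matrix.mulVec, dotProduct]
  refine Finset.sum_congr rfl fun q _ => ?_
  have h2 := comp_mul_left (hg b q) (c q) (d - e q)
  rw [add_comm, sub_add_sub_cancel] at h2
  exact h2

theorem isHomogSubmodule_ker {s t : ℕ} {deg : Fin t → Fin r → ℤ} {e : Fin s → Fin r → ℤ}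
    {g : Matrix (Fin t) (Fin s) (CoxRing k n)} (hg : ∀ b q, g b q ∈ grading k n (e q - deg b)) :
    IsHomogSubmodule e (LinearMap.ker g.mulVecLin) := by
  intro c hc d
  rw [LinearMap.mem_ker, Matrix.mulVecLin_apply] at hc ⊢
  rw [← vcomp_mulVec hg, hc]
  funext b
  exact map_zero _

/-- Graded Nakayama: the component of degree e q of a relation has a constant as its q-th entry. If
it were nonzero, the q-th generator would be a combination of the others. -/
theorem constantCoeff_eq_zero_of_mem_ker {s t : ℕ} {deg : Fin t → Fin r → ℤ}
    {e : Fin s → Fin r → ℤ} {g : Matrix (Fin t) (Fin s) (CoxRing k n)}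
    (hg : ∀ b q, g b q ∈ grading k n (e q - deg b))
    (hmin : ∀ q, g.col q ∉ Submodule.span (CoxRing k n) (g.col '' {q}ᶜ))
    {c : Fin s → CoxRing k n} (hc : c ∈ LinearMap.ker g.mulVecLin) (q : Fin s) :
    constantCoeff (c q) = 0 := by
  by_contra h0
  have h1 := isHomogSubmodule_ker hg c hc (e q)
  rw [LinearMap.mem_ker, Matrix.mulVecLin_apply, Matrix.mulVec_eq_sum] at h1
  simp only [op_smul_eq_smul] at h1
  change ∑ q', vcomp e (e q) c q' • g.col q' = 0 at h1
  have h2 : vcomp e (e q) c q = C (constantCoeff (c q)) := by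
    rw [vcomp, sub_self, comp_zero_eq_C]
  rw [← Finset.add_sum_erase _ _ (Finset.mem_univ q)] at h1
  refine hmin q ?_
  have h3 : g.col q = -(C (constantCoeff (c q))⁻¹ : CoxRing k n) •
      ∑ q' ∈ Finset.univ.erase q, vcomp e (e q) c q' • g.col q' := by
    have h4 := eq_neg_of_add_eq_zero_left h1
    rw [h2] at h4
    rw [neg_smul, ← smul_neg]
    refine Eq.trans ?_ (congrArg (fun v => (C (constantCoeff (c q))⁻¹ : CoxRing k n) • v) h4)
    rw [smul_smul, ← C_mul, inv_mul_cancel₀ h0, C_1, one_smul]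
  rw [h3]
  refine Submodule.smul_mem _ _ (sum_mem fun q' hq' => Submodule.smul_mem _ _ ?_)
  exact Submodule.subset_span ⟨q', Finset.ne_of_mem_erase hq', rfl⟩

theorem mul_eq_zero_of_forall_mulVecLin {R : Type*} [CommRing R] {l m p : ℕ}
    {A : Matrix (Fin l) (Fin m) R} {B : Matrix (Fin m) (Fin p) R}
    (h : ∀ v, B.mulVecLin v ∈ LinearMap.ker A.mulVecLin) : A * B = 0 := by
  refine Matrix.ext_of_mulVec_single fun q => ?_
  rw [← Matrix.mulVec_mulVec, Matrix.zero_mulVec]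
  exact h _

variable (k n) in
/-- A syzygy module in a graded free module, as it occurs in a minimal resolution. -/
structure Syzygies where
  /-- The rank of the free module. -/
  rank : ℕ
  /-- The degrees of the basis elements. -/
  deg : Fin rank → Fin r → ℤ
  /-- The syzygy module. -/
  ker : Submodule (CoxRing k n) (Fin rank → CoxRing k n)
  homog : IsHomogSubmodule deg ker
  minimal : ∀ v ∈ ker, ∀ b, constantCoeff (v b) = 0

namespace Syzygies

variable (K : Syzygies k n)

/-- The matrix of a minimal set of homogeneous generators. -/
noncomputable def gens :
    Matrix (Fin K.rank) (Fin K.homog.exists_minimal_generators.choose) (CoxRing k n) :=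
  K.homog.exists_minimal_generators.choose_spec.choose

/-- The degrees of a minimal set of homogeneous generators. -/
noncomputable def genDeg : Fin K.homog.exists_minimal_generators.choose → Fin r → ℤ :=
  K.homog.exists_minimal_generators.choose_spec.choose_spec.choose

theorem gens_mem (b q) : K.gens b q ∈ grading k n (K.genDeg q - K.deg b) :=
  K.homog.exists_minimal_generators.choose_spec.choose_spec.choose_spec.1 b q

theorem range_gens : LinearMap.range K.gens.mulVecLin = K.ker :=
  K.homog.exists_minimal_generators.choose_spec.choose_spec.choose_spec.2.1

/-- The next syzygy module. -/
noncomputable def next : Syzygies k n where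
  rank := K.homog.exists_minimal_generators.choose
  deg := K.genDeg
  ker := LinearMap.ker K.gens.mulVecLin
  homog := isHomogSubmodule_ker K.gens_mem
  minimal _ hv := constantCoeff_eq_zero_of_mem_ker K.gens_mem
    K.homog.exists_minimal_generators.choose_spec.choose_spec.choose_spec.2.2 hv

theorem gens_minimal (b q) : constantCoeff (K.gens b q) = 0 := by
  have h : K.gens.col q ∈ K.ker := by
    have h1 : K.gens.col q ∈ LinearMap.range K.gens.mulVecLin := by
      rw [Matrix.range_mulVecLin]
      exact Submodule.subset_span ⟨q, rfl⟩
    exact K.range_gens.le h1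
  exact K.minimal _ h b

/-- The iterated syzygy modules. -/
noncomputable def iterate : ℕ → Syzygies k n := fun i => Nat.rec K (fun _ K' => K'.next) i

/-- The minimal free complex with the given first syzygy module. -/
noncomputable def resolution : GradedFreeComplex k n where
  rank i := (K.iterate i).rank
  deg i := (K.iterate i).deg
  diff i := (K.iterate i).gens
  diff_mem i := (K.iterate i).gens_mem
  diff_mul_diff i := by
    have h : ∀ v, (K.iterate (i + 1)).gens.mulVecLin v ∈ LinearMap.ker (K.iterate i).gens.mulVecLin :=
      fun v => (K.iterate (i + 1)).range_gens.le ⟨v, rfl⟩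
    exact mul_eq_zero_of_forall_mulVecLin h

theorem resolution_exact (i : ℕ) :
    Function.Exact (K.resolution.diff (i + 1)).mulVecLin (K.resolution.diff i).mulVecLin :=
  LinearMap.exact_iff.2 (K.iterate (i + 1)).range_gens.symm

end Syzygies

variable {J : Ideal (CoxRing k n)}

theorem IsHomog.constantCoeff_eq_zero (hJ : IsHomog J) (hJ1 : J ≠ ⊤) {f : CoxRing k n}
    (hf : f ∈ J) : constantCoeff f = 0 := by
  by_contra h0
  have h1 := hJ f hf 0
  rw [comp_zero_eq_C] at h1
  exact hJ1 (Ideal.eq_top_of_isUnit_mem _ h1 ((IsUnit.mk0 _ h0).map C))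

/-- An ideal as a syzygy module in the free module of rank one. -/
noncomputable def idealSyzygies (hJ : IsHomog J) (hJ1 : J ≠ ⊤) : Syzygies k n where
  rank := 1
  deg _ := 0
  ker := Submodule.comap (LinearMap.proj 0) J
  homog v hv d := by
    have h := hJ (v 0) hv d
    change comp (d - 0) (v 0) ∈ J
    rwa [sub_zero]
  minimal v hv b := by
    rw [Subsingleton.elim b 0]
    exact hJ.constantCoeff_eq_zero hJ1 hv

theorem ker_mkQ_comp_proj (J : Ideal (CoxRing k n)) :
    LinearMap.ker (J.mkQ ∘ₗ LinearMap.proj (φ := fun _ : Fin 1 => CoxRing k n) 0) =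
      Submodule.comap (LinearMap.proj 0) J := by
  rw [LinearMap.ker_comp, Submodule.ker_mkQ]

theorem mkQ_comp_proj_single (J : Ideal (CoxRing k n)) (b : Fin 1) :
    (J.mkQ ∘ₗ LinearMap.proj (φ := fun _ : Fin 1 => CoxRing k n) 0) (Pi.single b 1) =
      Ideal.Quotient.mk J 1 := by
  rw [Subsingleton.elim b 0, LinearMap.comp_apply, LinearMap.proj_apply, Pi.single_eq_same]
  rfl

theorem IsHomog.exists_isMinimalFreeResolution (hJ : IsHomog J) (hJ1 : J ≠ ⊤) :
    ∃ F : GradedFreeComplex k n, F.IsMinimalFreeResolution J :=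
  ⟨(idealSyzygies hJ hJ1).resolution,
    ⟨J.mkQ ∘ₗ LinearMap.proj (φ := fun _ : Fin 1 => CoxRing k n) 0,
      fun b => ⟨1, one_mem_grading, mkQ_comp_proj_single J b⟩,
      (Submodule.mkQ_surjective J).comp fun f => ⟨fun _ => f, rfl⟩,
      LinearMap.exact_iff.2 ((ker_mkQ_comp_proj J).trans (idealSyzygies hJ hJ1).range_gens.symm),
      (idealSyzygies hJ hJ1).resolution_exact⟩,
    fun _ p q => mem_idealOfVars_iff.2 (Syzygies.gens_minimal _ p q)⟩

end Existence

/-! ### From free resolutions to virtual resolutions, and the exact length -/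

section VirtualResolution

open MvPolynomial

universe u

variable {k : Type u} [Field k] {r : ℕ} {n : Fin r → ℕ}

namespace GradedFreeComplex

variable {F : GradedFreeComplex k n} {J : Ideal (CoxRing k n)}

theorem IsMinimalFreeResolution.exists_freeRes (hF : F.IsMinimalFreeResolution J) :
    ∃ G : FreeRes (CoxRing k n) (CoxRing k n ⧸ J), G.rank = F.rank ∧
      G.IsMinimalAt (idealOfVars (Var n) k) := by
  obtain ⟨⟨ε, _, hsurj, h0, hsucc⟩, hmin⟩ := hF
  refine ⟨⟨F.rank, fun i => (F.diff i).mulVecLin, ε, hsurj, h0, hsucc⟩, rfl, fun i v b => ?_⟩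
  have h : (F.diff i).mulVec v b ∈ idealOfVars (Var n) k := by
    rw [Matrix.mulVec, dotProduct]
    exact sum_mem fun q _ => Ideal.mul_mem_right _ _ (hmin i b q)
  exact h

end GradedFreeComplex

theorem idealOfVars_ne_top {σ : Type} : idealOfVars σ k ≠ ⊤ := by
  rw [Ideal.ne_top_iff_one, mem_idealOfVars_iff, map_one]
  exact one_ne_zero

theorem exists_clear_denominators (σ : Chart n) {t : ℕ} {deg : Fin t → Fin r → ℤ}
    {v : Fin t → Loc k n σ} (hv : ∀ b, v b ∈ lineBundleSections k n σ (-deg b)) :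
    ∃ (M : ℕ) (w : Fin t → CoxRing k n), (∀ b, w b ∈ grading k n ((fun _ => (M : ℤ)) - deg b)) ∧
      ∀ b, v b * algebraMap (CoxRing k n) (Loc k n σ) (chartMonomial k n σ ^ M) =
        algebraMap (CoxRing k n) (Loc k n σ) (w b) := by
  choose m f hf hm using hv
  have hle : ∀ b, m b ≤ ∑ b, m b := fun b =>
    Finset.single_le_sum (f := m) (fun _ _ => Nat.zero_le _) (Finset.mem_univ b)
  refine ⟨∑ b, m b, fun b => chartMonomial k n σ ^ ((∑ b, m b) - m b) * f b, fun b => ?_,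
    fun b => ?_⟩
  · have h := grading_mul (chartMonomial_pow_mem σ ((∑ b, m b) - m b)) (hf b)
    have e : ((fun _ => (((∑ b, m b) - m b : ℕ) : ℤ)) + (-deg b + fun _ => (m b : ℤ))) =
        (fun _ => ((∑ b, m b : ℕ) : ℤ)) - deg b := by
      funext i
      have := hle b
      simp only [Pi.add_apply, Pi.neg_apply, Pi.sub_apply]
      lia
    rwa [e] at h
  · conv_lhs => rw [← Nat.sub_add_cancel (hle b), pow_add, map_mul, mul_left_comm, hm]
    rw [map_mul]

theorem exists_fractions (σ : Chart n) {t : ℕ} {deg : Fin t → Fin r → ℤ} (M : ℕ)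
    {w : Fin t → CoxRing k n} (hw : ∀ b, w b ∈ grading k n ((fun _ => (M : ℤ)) - deg b)) :
    ∃ v : Fin t → Loc k n σ, (∀ b, v b ∈ lineBundleSections k n σ (-deg b)) ∧
      ∀ b, v b * algebraMap (CoxRing k n) (Loc k n σ) (chartMonomial k n σ ^ M) =
        algebraMap (CoxRing k n) (Loc k n σ) (w b) := by
  obtain ⟨y, hy⟩ := isUnit_chartMonomial_pow (k := k) σ M
  have h : ∀ b, algebraMap (CoxRing k n) (Loc k n σ) (w b) * ((y⁻¹ : (Loc k n σ)ˣ) : Loc k n σ) *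
      algebraMap (CoxRing k n) (Loc k n σ) (chartMonomial k n σ ^ M) =
      algebraMap (CoxRing k n) (Loc k n σ) (w b) := fun b => by
    rw [← hy, Units.inv_mul_cancel_right]
  exact ⟨_, fun b => ⟨M, w b, by rw [neg_add_eq_sub]; exact hw b, h b⟩, h⟩

theorem map_mulVec_mul {R A : Type*} [CommRing R] [CommRing A] (f : R →+* A) {s t : ℕ}
    (g : Matrix (Fin t) (Fin s) R) {u : Fin s → A} {c : Fin s → R} {y : A}
    (h : ∀ q, u q * y = f (c q)) (b : Fin t) : (g.map f).mulVec u b * y = f (g.mulVec c b) := by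
  rw [Matrix.mulVec, dotProduct, Finset.sum_mul, Matrix.mulVec, dotProduct, map_sum]
  refine Finset.sum_congr rfl fun q _ => ?_
  rw [mul_assoc, h, map_mul, Matrix.map_apply]

theorem locLeft_algebraMap (σ τ : Chart n) (f : CoxRing k n) :
    locLeft k n σ τ (algebraMap _ _ f) = algebraMap _ _ f :=
  IsLocalization.Away.awayToAwayRight_eq _ _ f

theorem locRight_algebraMap (σ τ : Chart n) (f : CoxRing k n) :
    locRight k n σ τ (algebraMap _ _ f) = algebraMap _ _ f :=
  IsLocalization.Away.awayToAwayLeft_eq _ _ f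

theorem GradedFreeComplex.IsFreeResolution.isVirtualResolution {F : GradedFreeComplex k n}
    {I : Ideal (CoxRing k n)} (hI : IsHomog I) {a : Fin r → ℕ}
    (hF : F.IsFreeResolution (I ⊓ irrelevantPow k n a)) : F.IsVirtualResolution I := by
  obtain ⟨ε, hε, hsurj, h0, hsucc⟩ := hF
  choose f hf hεf using hε
  have hJ : IsHomog (I ⊓ irrelevantPow k n a) := hI.inf (isHomog_irrelevantPow a)
  have hε' : ∀ c, ε c = Ideal.Quotient.mk _ (∑ b, c b * f b) := by
    intro c
    conv_lhs => rw [pi_eq_sum_univ' c, map_sum]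
    rw [map_sum]
    refine Finset.sum_congr rfl fun b _ => ?_
    rw [map_smul, hεf]
    rfl
  have hker : ∀ c, ε c = 0 ↔ ∑ b, c b * f b ∈ I ⊓ irrelevantPow k n a := fun c => by
    rw [hε', Ideal.Quotient.eq_zero_iff_mem]
  have hcomp : ∀ (c : Fin (F.rank 0) → CoxRing k n) (d : Fin r → ℤ),
      ∑ b, vcomp (F.deg 0) d c b * f b = comp d (∑ b, c b * f b) := by
    intro c d
    rw [map_sum]
    refine Finset.sum_congr rfl fun b _ => ?_
    have h := comp_mul_left (hf b) (c b) (d - F.deg 0 b)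
    rw [add_sub_cancel, mul_comm, mul_comm (f b)] at h
    exact h.symm
  -- After clearing denominators, v is a homogeneous vector w of degree (M, …, M). Any preimage of w
  -- can be replaced by its component in that degree, and dividing by x_σ^M gives sections over U_σ.
  have hlift : ∀ (i M : ℕ) (σ : Chart n) (v : Fin (F.rank i) → Loc k n σ)
      (w : Fin (F.rank i) → CoxRing k n),
      (∀ b, w b ∈ grading k n ((fun _ => (M : ℤ)) - F.deg i b)) →
      (∀ b, v b * algebraMap (CoxRing k n) (Loc k n σ) (chartMonomial k n σ ^ M) =
        algebraMap (CoxRing k n) (Loc k n σ) (w b)) →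
      w ∈ Set.range (F.diff i).mulVecLin → ∃ u ∈ F.sections (i + 1) σ, F.sectionsDiff i σ u = v := by
    rintro i M σ v w hw hv ⟨c, rfl⟩
    obtain ⟨u, hu, huc⟩ := exists_fractions (k := k) σ (deg := F.deg (i + 1)) M
      (w := vcomp (F.deg (i + 1)) (fun _ => (M : ℤ)) c) fun b => comp_mem _ _
    refine ⟨u, hu, funext fun b => ?_⟩
    refine (isUnit_chartMonomial_pow (k := k) σ M).mul_right_cancel ?_
    rw [hv, sectionsDiff, map_mulVec_mul _ _ huc, ← vcomp_mulVec (F.diff_mem i)]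
    exact congrArg _ (comp_of_mem (hw b))
  -- The passage from I to I ∩ B^a: a further power of x_σ lies in B^a.
  have hmem : ∀ (σ : Chart n) (g : CoxRing k n),
      algebraMap (CoxRing k n) (Loc k n σ) g ∈ I.map (algebraMap (CoxRing k n) (Loc k n σ)) →
      ∃ l : ℕ, chartMonomial k n σ ^ l * g ∈ I ⊓ irrelevantPow k n a := by
    intro σ g hg
    obtain ⟨_, ⟨l, rfl⟩, hl⟩ := (IsLocalization.algebraMap_mem_map_algebraMap_iff
      (Submonoid.powers (chartMonomial k n σ)) _ _ _).1 hg
    refine ⟨(∑ i, a i) + l, ?_, ?_⟩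
    · rw [pow_add, mul_assoc]
      exact Ideal.mul_mem_left _ _ hl
    · rw [pow_add, mul_assoc]
      exact Ideal.mul_mem_right _ _ (chartMonomial_pow_mem_irrelevantPow σ a)
  have hsum : ∀ (σ : Chart n) (M : ℕ) (v : Fin (F.rank 0) → Loc k n σ)
      (w : Fin (F.rank 0) → CoxRing k n),
      (∀ b, v b * algebraMap (CoxRing k n) (Loc k n σ) (chartMonomial k n σ ^ M) =
        algebraMap (CoxRing k n) (Loc k n σ) (w b)) →
      (∑ b, v b * algebraMap (CoxRing k n) (Loc k n σ) (f b)) *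
        algebraMap (CoxRing k n) (Loc k n σ) (chartMonomial k n σ ^ M) =
        algebraMap (CoxRing k n) (Loc k n σ) (∑ b, w b * f b) := by
    intro σ M v w h
    rw [Finset.sum_mul, map_sum]
    refine Finset.sum_congr rfl fun b _ => ?_
    rw [mul_right_comm, h, map_mul]
  refine ⟨fun σ b => algebraMap _ _ (f b), fun σ b => ⟨0, f b, ?_, by simp⟩, fun σ τ b => ?_,
    fun σ => ⟨?_, ?_, ?_⟩⟩
  · have e : F.deg 0 b + (fun _ => ((0 : ℕ) : ℤ)) = F.deg 0 b := by
      funext i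
      simp
    rw [e]
    exact hf b
  · rw [locLeft_algebraMap, locRight_algebraMap, sub_self]
    exact zero_mem _
  · rintro z ⟨M, g, hg, hz⟩
    rw [zero_add] at hg
    obtain ⟨c, hc⟩ := hsurj (Ideal.Quotient.mk _ g)
    rw [hε', Ideal.Quotient.eq] at hc
    obtain ⟨u, hu, huc⟩ := exists_fractions (k := k) σ (deg := F.deg 0) M
      (w := vcomp (F.deg 0) (fun _ => (M : ℤ)) c) fun b => comp_mem _ _
    refine ⟨u, hu, (Ideal.mul_unit_mem_iff_mem _ (isUnit_chartMonomial_pow (k := k) σ M)).1 ?_⟩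
    have h1 := hJ _ hc (fun _ => (M : ℤ))
    rw [map_sub, comp_of_mem hg, ← hcomp] at h1
    rw [sub_mul, hz, hsum σ M u _ huc, ← map_sub, ← neg_sub, map_neg]
    exact neg_mem (Ideal.mem_map_of_mem _ h1.1)
  · intro v hv
    constructor
    · intro h
      obtain ⟨M, w, hw, hvw⟩ := exists_clear_denominators σ hv
      have h1 := Ideal.mul_mem_right
        (algebraMap (CoxRing k n) (Loc k n σ) (chartMonomial k n σ ^ M)) _ h
      rw [hsum σ M v w hvw] at h1
      obtain ⟨l, hl⟩ := hmem σ _ h1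
      -- The extra factor x_σ^l brings the relation into I ∩ B^a, so v is rewritten with denominator
      -- x_σ^(l + M).
      refine hlift 0 (l + M) σ v (fun b => chartMonomial k n σ ^ l * w b) (fun b => ?_)
        (fun b => ?_) ((h0 _).1 ((hker _).2 ?_))
      · have h2 := grading_mul (chartMonomial_pow_mem σ l) (hw b)
        rw [← add_sub_assoc] at h2
        exact h2
      · rw [pow_add, map_mul, mul_left_comm, hvw, map_mul]
      · simpa only [Finset.mul_sum, mul_assoc] using hl
    · rintro ⟨u, hu, rfl⟩
      obtain ⟨M, w, hw, hvw⟩ := exists_clear_denominators σ hu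
      refine (Ideal.mul_unit_mem_iff_mem _ (isUnit_chartMonomial_pow (k := k) σ M)).1 ?_
      rw [hsum σ M (F.sectionsDiff 0 σ u) _ (map_mulVec_mul _ _ hvw)]
      exact Ideal.mem_map_of_mem _ ((hker _).1 ((h0 _).2 ⟨w, rfl⟩)).1
  · intro i v hv
    constructor
    · intro h
      obtain ⟨M, w, hw, hvw⟩ := exists_clear_denominators σ hv
      refine hlift (i + 1) M σ v w hw hvw ((hsucc i w).1 (funext fun b => ?_))
      have h1 := map_mulVec_mul (algebraMap (CoxRing k n) (Loc k n σ)) (F.diff i) hvw b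
      change F.sectionsDiff i σ v b * _ = _ at h1
      rw [h, Pi.zero_apply, zero_mul] at h1
      refine IsLocalization.injective (Loc k n σ) (powers_le_nonZeroDivisors_of_noZeroDivisors
        (chartMonomial_ne_zero σ)) ?_
      rw [Pi.zero_apply, map_zero, h1]
      rfl
    · rintro ⟨u, hu, rfl⟩
      rw [sectionsDiff, sectionsDiff, Matrix.mulVec_mulVec, ← Matrix.map_mul, F.diff_mul_diff]
      rw [Matrix.map_zero _ (map_zero _), Matrix.zero_mulVec]

theorem ClosedSubscheme.hasLength (Z : ClosedSubscheme k n) (hZ : Z.dim = 0) {a : Fin r → ℕ}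
    (h : ExtVanishesFrom (R := CoxRing k n) (CoxRing k n ⧸ idealOfVars (Var n) k)
      ((∑ i, n i) + 1) (CoxRing k n ⧸ (Z.ideal ⊓ irrelevantPow k n a)))
    {F : GradedFreeComplex k n}
    (hF : F.IsMinimalFreeResolution (Z.ideal ⊓ irrelevantPow k n a)) :
    F.HasLength (∑ i, n i) := by
  obtain ⟨G, hG, hmin⟩ := hF.exists_freeRes
  rw [GradedFreeComplex.HasLength, ← hG]
  exact ⟨fun h0 => Z.not_projDimLT hZ a (FreeRes.projDimLT_of_rank_eq_zero _ G h0),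
    FreeRes.rank_eq_zero_of_extVanishesFrom idealOfVars_ne_top _ G hmin h⟩

theorem ClosedSubscheme.ideal_ne_top (Z : ClosedSubscheme k n) (hZ : Z.dim = 0) :
    Z.ideal ≠ ⊤ := by
  obtain ⟨σ, hσ⟩ := Z.exists_coneIdeal_ne_top hZ
  exact fun h => hσ (top_le_iff.1 (h ▸ Z.ideal_le_coneIdeal σ))

end VirtualResolution

end MultiProj

theorem theorem5p1 {k : Type*} [Field k] {r : ℕ} (n : Fin (r + 1) → ℕ)
    (hn : r = 0 ∨ 1 ≤ n (Fin.last r))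
    (Z : MultiProj.ClosedSubscheme k n) (hZ : Z.dim = 0) :
    ∃ N : ℕ, ∀ a : Fin (r + 1) → ℕ, a (Fin.last r) = 0 →
      (∀ i, i ≠ Fin.last r → N ≤ a i) →
      (∃ F : MultiProj.GradedFreeComplex k n,
        F.IsMinimalFreeResolution (Z.ideal ⊓ MultiProj.irrelevantPow k n a)) ∧
      ∀ F : MultiProj.GradedFreeComplex k n,
        F.IsMinimalFreeResolution (Z.ideal ⊓ MultiProj.irrelevantPow k n a) →
          F.HasLength (∑ i, n i) ∧ F.IsVirtualResolution Z.ideal := by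
  obtain ⟨N, hN⟩ := Z.exists_extVanishesFrom hZ (o := Fin.last r) (by simpa using hn)
  refine ⟨N, fun a ha0 ha => ⟨?_, fun F hF => ⟨Z.hasLength hZ (hN a ha0 ha) hF,
    hF.1.isVirtualResolution Z.isHomog_ideal⟩⟩⟩
  exact (Z.isHomog_ideal.inf (MultiProj.isHomog_irrelevantPow a)).exists_isMinimalFreeResolution
    (ne_top_of_le_ne_top (Z.ideal_ne_top hZ) inf_le_left)
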